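/- Let $n\ge1$, $0<\theta\le1$, $m>0$, and let $\|\cdot\|$ be the norm of $L^2(\mathbf R^n)$. Let $L_\theta=\log(I+(-\Delta)^\theta)$ be the operator in $L^2(\mathbf R^n)$ with Fourier symbol $\log(1+|\xi|^{2\theta})$, where $\hat f(\xi)=\int e^{-ix\cdot\xi}f(x)\,dx$. Consider $$u_{tt}-\Delta u+m^2L_\theta u-\Delta u_t=0\quad(t>0),\qquad u(0)=0,\qquad u_t(0)=u_1 .$$ Let $u_1\in L^2(\mathbf R^n)\cap L^{1,\theta}(\mathbf R^n)$, that is, $u_1\in L^2$, $\|u_1\|_1=\int|u_1|\,dx<\infty$ and $\|u_1\|_{1,\theta}=\int(1+|x|^\theta)|u_1(x)|\,dx<\infty$, and put $P_1=\int u_1\,dx$ ($u_1$ real- or complex-valued). Let $u\in C([0,\infty);H^1)\cap C^1([0,\infty);L^2)$ be the mild solution: with $U=(u,u_t)$, which is continuous from $[0,\infty)$ to $H^1\times L^2$, one has $\int_0^tU\,ds\in D(A)$ and $U(t)=(0,u_1)+A\int_0^tU\,ds$ for all $t\ge0$, where $A(w,z)=(z,\Delta(w+z)-m^2L_\theta w)$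 and $D(A)=\{(w,z)\in H^1\times H^1: w+z\in H^2\}$. Below, "for $t\gg1$" means for all $t\ge T$, where $T$ may depend on $n,\theta,m$ and $u_1$. - (i) If $n=1$ and $0<\theta<\frac12$, or $n=2$ and $0<\theta<1$, or $n\ge3$ and $0<\theta\le1$, there are constants $C_1,C_2>0$ depending only on $n,\theta,m$ such that, for $t\gg1$, $$C_1|P_1|\,t^{-\frac{n-2\theta}{4}}\le\|u(t)\|\le C_2\left(\|u_1\|_1+\|u_1\|_{1,\theta}\right)t^{-\frac{n-2\theta}{4}}.$$ - (ii) There is an absolute constant $C_1>0$ and, for every $M>0$, a constant $C_2>0$ depending only on $M$ such that, if $n=1$, $\frac12<\theta\le1$ and $0<m\le M$, then, for $t\gg1$, $$\frac{C_1}{(1+m^2)^{\frac1{4\theta}}}|P_1|\,t^{\frac{2\theta-1}{2\theta}}\le\|u(t)\|\le\frac{C_2}{m}\frac1{\sqrt{2\theta-1}}\left(\|u_1\|_1+\|u_1\|_{1,\theta}\right)t^{\frac{2\theta-1}{2\theta}}.$$ - (iii) There are absolute constants $C_1,C_2>0$ such that, if $n=1$ and $\theta=\frac12$, or $n=2$ and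 $\theta=1$, then, for every $m>0$ and for $t\gg1$, $$\frac{C_1}{\sqrt{2+m^2}}|P_1|\sqrt{\log t}\le\|u(t)\|\le\frac{C_2}{m}\left(\|u_1\|_1+\|u_1\|_{1,\theta}\right)\sqrt{\log t}.$$ -/

import Mathlib

open MeasureTheory Filter Set FourierTransform
open scoped ENNReal Topology

/-- The complex Hilbert space `L²(ℝⁿ)`; its norm is `‖·‖`. -/
abbrev L2 (n : ℕ) : Type := Lp ℂ 2 (volume : Measure (EuclideanSpace ℝ (Fin n)))

/-- The multiplication operator `g ↦ σ · g` in `L²(ℝⁿ)` on its maximal domain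
`{g ∈ L² | σ · g ∈ L²}`. -/
noncomputable def mulOp {n : ℕ} (σ : EuclideanSpace ℝ (Fin n) → ℝ) : L2 n →ₗ.[ℂ] L2 n where
  domain :=
    { carrier := {g | MemLp (fun ξ => (σ ξ : ℂ) * g ξ) 2 volume}
      add_mem' := by
        intro f g hf hg
        refine MemLp.ae_eq ?_ (MemLp.add hf hg)
        filter_upwards [Lp.coeFn_add f g] with ξ h
        simp only [Pi.add_apply] at h ⊢
        rw [h, mul_add]
      zero_mem' := by
        refine MemLp.ae_eq ?_ (MemLp.zero (ε := ℂ))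
        filter_upwards [Lp.coeFn_zero ℂ 2 (volume : Measure (EuclideanSpace ℝ (Fin n)))] with ξ h
        rw [h]
        simp
      smul_mem' := by
        intro c f hf
        refine MemLp.ae_eq ?_ (MemLp.const_smul hf c)
        filter_upwards [Lp.coeFn_smul c f] with ξ h
        simp only [Pi.smul_apply, smul_eq_mul] at h ⊢
        rw [h]
        ring }
  toFun :=
    { toFun := fun f => MemLp.toLp (fun ξ => (σ ξ : ℂ) * (f : L2 n) ξ) f.2
      map_add' := by
        intro f g
        apply Lp.ext
        refine (MemLp.coeFn_toLp _).trans ?_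
        refine Filter.EventuallyEq.trans ?_ (Lp.coeFn_add _ _).symm
        filter_upwards [Lp.coeFn_add (f : L2 n) (g : L2 n),
          MemLp.coeFn_toLp f.2, MemLp.coeFn_toLp g.2] with ξ h h1 h2
        simp only [Pi.add_apply, Submodule.coe_add] at h ⊢
        rw [h, h1, h2, mul_add]
      map_smul' := by
        intro c f
        apply Lp.ext
        refine (MemLp.coeFn_toLp _).trans ?_
        refine Filter.EventuallyEq.trans ?_ (Lp.coeFn_smul _ _).symm
        filter_upwards [Lp.coeFn_smul c (f : L2 n), MemLp.coeFn_toLp f.2] with ξ h h1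
        simp only [Pi.smul_apply, smul_eq_mul, Submodule.coe_smul, RingHom.id_apply] at h ⊢
        rw [h, h1]
        ring }

/-- The Fourier multiplier operator `f ↦ 𝓕⁻¹ (σ · 𝓕 f)` in `L²(ℝⁿ)` with real symbol `σ`, as an
unbounded operator on its maximal domain `{f ∈ L² | σ · 𝓕 f ∈ L²}`. Mathlib's transform is
`𝓕 f ξ = ∫ exp (-2πi x·ξ) f x dx`, so the frequency variable of the transform with kernel
`exp (-i x·ξ)` is `2πξ` here. -/
noncomputable def fourierMul {n : ℕ} (σ : EuclideanSpace ℝ (Fin n) → ℝ) : L2 n →ₗ.[ℂ] L2 n where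
  domain := (mulOp σ).domain.comap
    (Lp.fourierTransformₗᵢ (EuclideanSpace ℝ (Fin n)) ℂ).toLinearEquiv.toLinearMap
  toFun := (Lp.fourierTransformₗᵢ (EuclideanSpace ℝ (Fin n)) ℂ).symm.toLinearEquiv.toLinearMap ∘ₗ
    (mulOp σ).toFun ∘ₗ
      (Lp.fourierTransformₗᵢ (EuclideanSpace ℝ (Fin n)) ℂ).toLinearEquiv.toLinearMap.submoduleComap
        (mulOp σ).domain

theorem mem_fourierMul_domain {n : ℕ} (σ : EuclideanSpace ℝ (Fin n) → ℝ) (f : L2 n) :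
    f ∈ (fourierMul σ).domain ↔ MemLp (fun ξ => (σ ξ : ℂ) * (𝓕 f : L2 n) ξ) 2 volume := Iff.rfl

theorem fourier_fourierMul {n : ℕ} (σ : EuclideanSpace ℝ (Fin n) → ℝ)
    (f : (fourierMul σ).domain) :
    (𝓕 (fourierMul σ f) : L2 n) =ᵐ[volume] fun ξ => (σ ξ : ℂ) * (𝓕 (f : L2 n) : L2 n) ξ := by
  have h : (𝓕 (fourierMul σ f) : L2 n) =
      MemLp.toLp (fun ξ => (σ ξ : ℂ) * (𝓕 (f : L2 n) : L2 n) ξ) f.2 :=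
    (Lp.fourierTransformₗᵢ (EuclideanSpace ℝ (Fin n)) ℂ).apply_symm_apply _
  rw [h]
  exact MemLp.coeFn_toLp _

/-- The Laplace operator `Δ` in `L²(ℝⁿ)`, with domain `H²(ℝⁿ)`. -/
noncomputable def laplaceOp (n : ℕ) : L2 n →ₗ.[ℂ] L2 n :=
  fourierMul fun ξ => -(2 * Real.pi * ‖ξ‖) ^ 2

/-- The operator `L_θ = log (I + (-Δ)^θ)` in `L²(ℝⁿ)`, with its maximal domain. -/
noncomputable def logLaplaceOp (n : ℕ) (θ : ℝ) : L2 n →ₗ.[ℂ] L2 n :=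
  fourierMul fun ξ => Real.log (1 + (2 * Real.pi * ‖ξ‖) ^ (2 * θ))

/-- The `H¹(ℝⁿ)`-norm `(∫ (1 + |ξ|²) |f̂(ξ)|² dξ)^{1/2}` of `f ∈ L²`, equal to `∞` if `f ∉ H¹`. -/
noncomputable def h1ENorm {n : ℕ} (f : L2 n) : ℝ≥0∞ :=
  eLpNorm (fun ξ => (Real.sqrt (1 + (2 * Real.pi * ‖ξ‖) ^ 2) : ℂ) * (𝓕 f : L2 n) ξ) 2 volume

/-- `f ∈ H¹(ℝⁿ)`. -/
def MemH1 {n : ℕ} (f : L2 n) : Prop := h1ENorm f < ⊤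

/-- `u ∈ C([0, ∞); H¹(ℝⁿ))`. -/
def ContinuousInH1 {n : ℕ} (u : ℝ → L2 n) : Prop :=
  (∀ t, 0 ≤ t → MemH1 (u t)) ∧
    ∀ t, 0 ≤ t → Tendsto (fun s => h1ENorm (u s - u t)) (𝓝[Ici 0] t) (𝓝 0)

/-- `u`, with time derivative `v = u_t`, is a mild solution of
`u_tt - Δu + m² L_θ u - Δu_t = 0`, `u(0) = u₀`, `u_t(0) = u₁`.

With `U = (u, v)` the problem is `U' = A U`, `U(0) = (u₀, u₁)` in the space `H¹ × L²`, where
`A (w, z) = (z, Δ(w + z) - m² L_θ w)` on the domain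
`D(A) = {(w, z) ∈ H¹ × H¹ | w + z ∈ H²}`; a mild solution is a continuous
`U : [0, ∞) → H¹ × L²` such that `∫₀ᵗ U ∈ D(A)` and `U(t) = U(0) + A ∫₀ᵗ U` for all `t ≥ 0`.
The first component of this identity gives `u ∈ C¹([0, ∞); L²)` and `u_t = v`. -/
structure IsMildSolution {n : ℕ} (m θ : ℝ) (u₀ u₁ : L2 n) (u v : ℝ → L2 n) : Prop where
  continuous_fst : ContinuousInH1 u
  continuous_snd : ContinuousOn v (Ici 0)
  mem_fst : ∀ t, 0 ≤ t → MemH1 (∫ s in (0 : ℝ)..t, u s)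
  mem_snd : ∀ t, 0 ≤ t → MemH1 (∫ s in (0 : ℝ)..t, v s)
  eq_fst : ∀ t, 0 ≤ t → u t = u₀ + ∫ s in (0 : ℝ)..t, v s
  eq_snd : ∀ t, 0 ≤ t →
    ∃ (hL : (∫ s in (0 : ℝ)..t, u s) ∈ (logLaplaceOp n θ).domain)
      (hD : (∫ s in (0 : ℝ)..t, u s) + (∫ s in (0 : ℝ)..t, v s) ∈ (laplaceOp n).domain),
      v t = u₁ + (laplaceOp n ⟨_, hD⟩ - ((m : ℂ) ^ 2) • logLaplaceOp n θ ⟨_, hL⟩)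

/-- `f ∈ L^{1,θ}(ℝⁿ)`: both `f` and `(1 + |x|^θ) f` are integrable. -/
def MemWeightedL1 {n : ℕ} (θ : ℝ) (f : L2 n) : Prop :=
  Integrable (fun x => f x) volume ∧ Integrable (fun x => (1 + ‖x‖ ^ θ) * ‖f x‖) volume

/-- `‖f‖₁ = ∫ |f(x)| dx`. -/
noncomputable def l1Norm {n : ℕ} (f : L2 n) : ℝ := ∫ x, ‖f x‖

/-- `‖f‖_{1,θ} = ∫ (1 + |x|^θ) |f(x)| dx`. -/
noncomputable def weightedL1Norm {n : ℕ} (θ : ℝ) (f : L2 n) : ℝ := ∫ x, (1 + ‖x‖ ^ θ) * ‖f x‖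

/-- The moment `P₁ = ∫ u₁(x) dx`. -/
noncomputable def moment {n : ℕ} (u₁ : L2 n) : ℂ := ∫ x, u₁ x

/-!
The Fourier transform turns the equation into the ordinary differential equation
`y'' + r² y' + (r² + m² log (1 + r^{2θ})) y = 0` for each frequency `r = 2π|ξ|`. Its characteristic
roots are `-r²/2 ± i ω` with `ω² = freqSq m θ r`.

A mild solution is only known to satisfy the integrated equation in `L²`. Restricted to a bounded
range of frequencies the coefficients become bounded multiplication operators `bddMul`, the mild
solution becomes twice differentiable (`IsMildSolution.exists_secondOrder`), and the equation is
solved by factoring it into two first-order equations. This yields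

* for `r ≤ 1`, where `ω² > 0`, the closed form `exp (-r² t / 2) sin (ω t) / ω · 𝓕 u₁`
  (`IsMildSolution.fourier_eq_of_le_one`);
* for `r > 1`, where both roots have real part at most `-1/2`, an `L²` bound by
  `t exp (-t / 2) ‖u₁‖` that is insensitive to coinciding roots
  (`IsMildSolution.integral_fourier_sq_le`).

The transform of `u₁` is continuous, bounded by `‖u₁‖₁`, and equal to the moment at the origin.
Hence, by Plancherel, `‖u(t)‖²` is bounded above by `‖u₁‖₁²` times the radial integral
`∫₀¹ r^{n-1} exp (-r² t) sin² (ω t) / ω² dr`, up to an exponentially small term, and below by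
`|P₁|²/4` times the same integral over any interval close to zero, up to the same constant.

For small `r` the frequency `ω` is comparable to `r^θ`. The upper bounds follow from
`|sin (ω t) / ω| ≤ min t (1 / ω)` together with the Gaussian factor. For the lower bounds in the
decaying and in the logarithmic case the oscillation is averaged: with `w = ω(r)` as the variable
of integration, `r^{n-1} sin² (ω t) / ω² dr` dominates a multiple of `sin² (w t) / w dw`, whose
integral is half the logarithm of the ratio of the end points up to a small error
(`le_integral_waveKernel_sq`). The decay uses `r ≈ t^{-1/2}`, the logarithmic growth
`t^{-3/4} < r < t^{-1/2}`. In the polynomially growing case the frequencies below the first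
oscillation, `r ≲ t^{-1/θ}`, suffice.
-/

/-! ### Multiplication operators with bounded symbols -/

section Multiplication

variable {α : Type*} [MeasurableSpace α] {μ : Measure α}

/-- A measurable function that is bounded everywhere. -/
structure IsBddMeasurable (φ : α → ℂ) : Prop where
  measurable : Measurable φ
  bdd : ∃ C : ℝ, ∀ x, ‖φ x‖ ≤ C

namespace IsBddMeasurable

variable {φ ψ : α → ℂ}

theorem mul (hφ : IsBddMeasurable φ) (hψ : IsBddMeasurable ψ) :
    IsBddMeasurable fun x => φ x * ψ x := by
  obtain ⟨C, hC⟩ := hφ.bdd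
  obtain ⟨D, hD⟩ := hψ.bdd
  refine ⟨hφ.measurable.mul hψ.measurable, C * D, fun x => ?_⟩
  rw [norm_mul]
  exact mul_le_mul (hC x) (hD x) (norm_nonneg _) ((norm_nonneg _).trans (hC x))

theorem exp_mul (hφ : IsBddMeasurable φ) (t : ℝ) :
    IsBddMeasurable fun x => Complex.exp (t * φ x) := by
  obtain ⟨C, hC⟩ := hφ.bdd
  have := hφ.measurable
  refine ⟨by fun_prop, Real.exp (|t| * C), fun x => ?_⟩
  rw [Complex.norm_exp, Real.exp_le_exp]
  calc ((t : ℂ) * φ x).re ≤ ‖(t : ℂ) * φ x‖ := Complex.re_le_norm _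
    _ = |t| * ‖φ x‖ := by rw [norm_mul, Complex.norm_real, Real.norm_eq_abs]
    _ ≤ |t| * C := by gcongr; exact hC x

theorem memLp_mul (hφ : IsBddMeasurable φ) (f : Lp ℂ 2 μ) :
    MemLp (fun x => φ x * f x) 2 μ := by
  obtain ⟨C, hC⟩ := hφ.bdd
  refine MemLp.of_le_mul (c := C) (Lp.memLp f)
    (hφ.measurable.aestronglyMeasurable.mul (Lp.aestronglyMeasurable f)) ?_
  filter_upwards with x
  rw [norm_mul]
  gcongr
  exact hC x

end IsBddMeasurable

/-- Multiplication by a bounded measurable function, as a bounded operator on `L²`. It is taken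
real linear, since it is to be differentiated along curves parametrized by real time. -/
noncomputable def bddMul {φ : α → ℂ} (hφ : IsBddMeasurable φ) : Lp ℂ 2 μ →L[ℝ] Lp ℂ 2 μ :=
  LinearMap.mkContinuousOfExistsBound
    { toFun := fun f => (hφ.memLp_mul f).toLp _
      map_add' := fun f g => by
        apply Lp.ext
        filter_upwards [(hφ.memLp_mul (f + g)).coeFn_toLp, (hφ.memLp_mul f).coeFn_toLp,
          (hφ.memLp_mul g).coeFn_toLp, Lp.coeFn_add f g,
          Lp.coeFn_add ((hφ.memLp_mul f).toLp _) ((hφ.memLp_mul g).toLp _)] with x h1 h2 h3 h4 h5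
        rw [h1, h5, Pi.add_apply, h2, h3, h4, Pi.add_apply, mul_add]
      map_smul' := fun c f => by
        apply Lp.ext
        filter_upwards [(hφ.memLp_mul (c • f)).coeFn_toLp, (hφ.memLp_mul f).coeFn_toLp,
          Lp.coeFn_smul c f, Lp.coeFn_smul c ((hφ.memLp_mul f).toLp _)] with x h1 h2 h3 h4
        rw [h1, RingHom.id_apply, h4, Pi.smul_apply, h2, h3, Pi.smul_apply, mul_smul_comm] }
    (by
      obtain ⟨C, hC⟩ := hφ.bdd
      refine ⟨C, fun f => Lp.norm_le_mul_norm_of_ae_le_mul ?_⟩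
      filter_upwards [(hφ.memLp_mul f).coeFn_toLp] with x h
      simp only [LinearMap.coe_mk, AddHom.coe_mk]
      rw [h, norm_mul]
      gcongr
      exact hC x)

variable {φ ψ : α → ℂ}

theorem coeFn_bddMul (hφ : IsBddMeasurable φ) (f : Lp ℂ 2 μ) :
    bddMul hφ f =ᵐ[μ] fun x => φ x * f x :=
  (hφ.memLp_mul f).coeFn_toLp

theorem norm_bddMul_apply_le (hφ : IsBddMeasurable φ) {C : ℝ} (hC : ∀ x, ‖φ x‖ ≤ C)
    (f : Lp ℂ 2 μ) : ‖bddMul hφ f‖ ≤ C * ‖f‖ := by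
  refine Lp.norm_le_mul_norm_of_ae_le_mul ?_
  filter_upwards [coeFn_bddMul hφ f] with x h
  rw [h, norm_mul]
  gcongr
  exact hC x

theorem bddMul_bddMul (hφ : IsBddMeasurable φ) (hψ : IsBddMeasurable ψ) (f : Lp ℂ 2 μ) :
    bddMul hφ (bddMul hψ f) = bddMul (hφ.mul hψ) f := by
  apply Lp.ext
  filter_upwards [coeFn_bddMul hφ (bddMul hψ f), coeFn_bddMul hψ f,
    coeFn_bddMul (hφ.mul hψ) f] with x h1 h2 h3
  rw [h1, h2, h3, mul_assoc]

/-- The operators `exp (t φ)` are differentiable in `t` in operator norm: the second-order Taylor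
remainder of the exponential is uniform because `φ` is bounded. -/
theorem hasDerivAt_bddMul_exp (hφ : IsBddMeasurable φ) (t : ℝ) :
    HasDerivAt (fun s : ℝ => (bddMul (hφ.exp_mul s) : Lp ℂ 2 μ →L[ℝ] Lp ℂ 2 μ))
      (bddMul (hφ.mul (hφ.exp_mul t))) t := by
  obtain ⟨C, hC⟩ := hφ.bdd
  obtain ⟨D, hD⟩ := (hφ.exp_mul t).bdd
  have hC' : ∀ x, ‖φ x‖ ≤ |C| := fun x => (hC x).trans (le_abs_self C)
  have hD' : ∀ x, ‖Complex.exp (t * φ x)‖ ≤ |D| := fun x => (hD x).trans (le_abs_self D)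
  rw [hasDerivAt_iff_isLittleO_nhds_zero]
  have hbig : (fun h : ℝ => (bddMul (hφ.exp_mul (t + h)) : Lp ℂ 2 μ →L[ℝ] Lp ℂ 2 μ) -
      bddMul (hφ.exp_mul t) - h • bddMul (hφ.mul (hφ.exp_mul t)))
      =O[𝓝 0] fun h : ℝ => h ^ 2 := by
    refine Asymptotics.IsBigO.of_bound (|D| * |C| ^ 2) ?_
    have hsmall : ∀ᶠ h : ℝ in 𝓝 0, |h| * |C| < 1 := by
      have : Tendsto (fun h : ℝ => |h| * |C|) (𝓝 0) (𝓝 (|0| * |C|)) :=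
        (continuous_abs.mul continuous_const).tendsto 0
      refine this.eventually_lt_const ?_
      simp
    filter_upwards [hsmall] with h hh
    refine ContinuousLinearMap.opNorm_le_bound _ (by positivity) fun f => ?_
    refine Lp.norm_le_mul_norm_of_ae_le_mul ?_
    have hval : (bddMul (hφ.exp_mul (t + h)) - bddMul (hφ.exp_mul t) -
      h • bddMul (hφ.mul (hφ.exp_mul t)) : Lp ℂ 2 μ →L[ℝ] Lp ℂ 2 μ) f =
      bddMul (hφ.exp_mul (t + h)) f - bddMul (hφ.exp_mul t) f -
        h • bddMul (hφ.mul (hφ.exp_mul t)) f := rfl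
    rw [hval]
    filter_upwards [Lp.coeFn_sub (bddMul (hφ.exp_mul (t + h)) f - bddMul (hφ.exp_mul t) f)
        (h • bddMul (hφ.mul (hφ.exp_mul t)) f),
      Lp.coeFn_sub (bddMul (hφ.exp_mul (t + h)) f) (bddMul (hφ.exp_mul t) f),
      Lp.coeFn_smul h (bddMul (hφ.mul (hφ.exp_mul t)) f),
      coeFn_bddMul (hφ.exp_mul (t + h)) f, coeFn_bddMul (hφ.exp_mul t) f,
      coeFn_bddMul (hφ.mul (hφ.exp_mul t)) f] with x h1 h2 h3 h4 h5 h6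
    rw [h1, Pi.sub_apply, h2, Pi.sub_apply, h3, Pi.smul_apply, h4, h5, h6]
    have hz : ‖(h : ℂ) * φ x‖ ≤ |h| * |C| := by
      rw [norm_mul, Complex.norm_real, Real.norm_eq_abs]
      gcongr
      exact hC' x
    have hfac : Complex.exp (((t + h : ℝ) : ℂ) * φ x) * f x - Complex.exp (t * φ x) * f x -
        h • (φ x * Complex.exp (t * φ x) * f x) =
        Complex.exp (t * φ x) * (Complex.exp (h * φ x) - 1 - h * φ x) * f x := by
      rw [Complex.ofReal_add, add_mul, Complex.exp_add, Complex.real_smul]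
      ring
    rw [hfac, norm_mul, norm_mul]
    have hexp := Complex.norm_exp_sub_one_sub_id_le (hz.trans hh.le)
    calc ‖Complex.exp (t * φ x)‖ * ‖Complex.exp (h * φ x) - 1 - h * φ x‖ * ‖f x‖
        ≤ |D| * (|h| * |C|) ^ 2 * ‖f x‖ := by
          gcongr
          · exact hD' x
          · exact hexp.trans (by gcongr)
      _ = |D| * |C| ^ 2 * ‖h ^ 2‖ * ‖f x‖ := by
          rw [norm_pow, Real.norm_eq_abs]; ring
  refine hbig.trans_isLittleO ?_
  simpa using (Asymptotics.isLittleO_pow_id (𝕜 := ℝ) (n := 2) (by norm_num))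

theorem HasDerivAt.bddMul_exp (hφ : IsBddMeasurable φ) {y : ℝ → Lp ℂ 2 μ} {y' : Lp ℂ 2 μ} {t : ℝ}
    (hy : HasDerivAt y y' t) :
    HasDerivAt (fun s : ℝ => bddMul (hφ.exp_mul s) (y s))
      (bddMul (hφ.exp_mul t) (y' + bddMul hφ (y t))) t := by
  convert! (hasDerivAt_bddMul_exp hφ t).clm_apply hy using 1
  rw [map_add, bddMul_bddMul, add_comm]
  congr 3
  ext x
  ring

/-! ### A second-order equation with multiplication operators as coefficients -/

/-- `p' = φ p` has only the exponential solution. -/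
theorem eq_bddMul_exp_of_hasDerivAt (hφ : IsBddMeasurable φ) {p p' : ℝ → Lp ℂ 2 μ}
    (hp : ∀ t, 0 ≤ t → HasDerivAt p (p' t) t) (hp' : ∀ t, 0 ≤ t → p' t = bddMul hφ (p t))
    {t : ℝ} (ht : 0 ≤ t) : p t = bddMul (hφ.exp_mul t) (p 0) := by
  have hneg : IsBddMeasurable fun x => (-1 : ℂ) * φ x :=
    IsBddMeasurable.mul ⟨measurable_const, 1, fun x => by simp⟩ hφ
  have hder : ∀ s, 0 ≤ s →
      HasDerivAt (fun s => bddMul (hneg.exp_mul s) (p s)) 0 s := fun s hs => by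
    convert! (hp s hs).bddMul_exp hneg using 1
    rw [hp' s hs]
    have : bddMul hφ (p s) + bddMul hneg (p s) = 0 := by
      apply Lp.ext
      filter_upwards [Lp.coeFn_add (bddMul hφ (p s)) (bddMul hneg (p s)), coeFn_bddMul hφ (p s),
        coeFn_bddMul hneg (p s), Lp.coeFn_zero ℂ 2 μ] with x h1 h2 h3 h4
      rw [h1, Pi.add_apply, h2, h3, h4, Pi.zero_apply]
      ring
    rw [this, map_zero]
  have hconst := constant_of_has_deriv_right_zero (a := 0) (b := t)
    (fun s hs => (hder s hs.1).continuousAt.continuousWithinAt)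
    (fun s hs => (hder s hs.1).hasDerivWithinAt) t ⟨ht, le_rfl⟩
  have happ := congrArg (bddMul (hφ.exp_mul t)) hconst
  apply Lp.ext
  filter_upwards [coeFn_bddMul (hφ.exp_mul t) (bddMul (hneg.exp_mul t) (p t)),
    coeFn_bddMul (hφ.exp_mul t) (bddMul (hneg.exp_mul 0) (p 0)),
    coeFn_bddMul (hneg.exp_mul t) (p t), coeFn_bddMul (hneg.exp_mul 0) (p 0),
    coeFn_bddMul (hφ.exp_mul t) (p 0)] with x h1 h2 h3 h4 h5
  rw [happ, h2, h4, h3] at h1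
  have hinv : p t x =
      Complex.exp (t * φ x) * (Complex.exp (t * (-1 * φ x)) * p t x) := by
    rw [← mul_assoc, ← Complex.exp_add]
    simp
  rw [h5, hinv, ← h1]
  simp

/-- If the monic polynomial with roots `φ`, `ψ` annihilates `y`, then the factor belonging to `φ`
maps `y` to an exponential with exponent `ψ`. -/
theorem sub_bddMul_eq_bddMul_exp (hφ : IsBddMeasurable φ) (hψ : IsBddMeasurable ψ)
    {y v v' : ℝ → Lp ℂ 2 μ} (hy : ∀ t, 0 ≤ t → HasDerivAt y (v t) t)
    (hv : ∀ t, 0 ≤ t → HasDerivAt v (v' t) t)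
    (hv' : ∀ t, 0 ≤ t → v' t =ᵐ[μ] fun x => (φ x + ψ x) * v t x - φ x * ψ x * y t x)
    (hy0 : y 0 = 0) {t : ℝ} (ht : 0 ≤ t) :
    v t - bddMul hφ (y t) = bddMul (hψ.exp_mul t) (v 0) := by
  have hder : ∀ s, 0 ≤ s → HasDerivAt (fun s => v s - bddMul hφ (y s))
      (v' s - bddMul hφ (v s)) s := fun s hs =>
    (hv s hs).sub ((bddMul hφ).hasFDerivAt.comp_hasDerivAt s (hy s hs))
  have h := eq_bddMul_exp_of_hasDerivAt hψ hder (fun s hs => ?_) ht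
  · simpa [hy0] using h
  · apply Lp.ext
    filter_upwards [hv' s hs, Lp.coeFn_sub (v' s) (bddMul hφ (v s)),
      Lp.coeFn_sub (v s) (bddMul hφ (y s)), coeFn_bddMul hφ (v s), coeFn_bddMul hφ (y s),
      coeFn_bddMul hψ (v s - bddMul hφ (y s))] with x h1 h2 h3 h4 h5 h6
    rw [h2, h6, Pi.sub_apply, h3, Pi.sub_apply, h1, h4, h5]
    ring

/-- Closed form of the solution of the second-order problem, multiplied by the difference of the
characteristic roots. -/
theorem sub_mul_secondOrder_eq (hφ : IsBddMeasurable φ) (hψ : IsBddMeasurable ψ)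
    {y v v' : ℝ → Lp ℂ 2 μ} (hy : ∀ t, 0 ≤ t → HasDerivAt y (v t) t)
    (hv : ∀ t, 0 ≤ t → HasDerivAt v (v' t) t)
    (hv' : ∀ t, 0 ≤ t → v' t =ᵐ[μ] fun x => (φ x + ψ x) * v t x - φ x * ψ x * y t x)
    (hy0 : y 0 = 0) {t : ℝ} (ht : 0 ≤ t) :
    ∀ᵐ x ∂μ, (φ x - ψ x) * y t x =
      (Complex.exp (t * φ x) - Complex.exp (t * ψ x)) * v 0 x := by
  have h1 := sub_bddMul_eq_bddMul_exp hφ hψ hy hv hv' hy0 ht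
  have h2 := sub_bddMul_eq_bddMul_exp hψ hφ hy hv
    (fun s hs => (hv' s hs).trans (.of_forall fun x => by ring)) hy0 ht
  filter_upwards [Lp.coeFn_sub (v t) (bddMul hφ (y t)), Lp.coeFn_sub (v t) (bddMul hψ (y t)),
    coeFn_bddMul hφ (y t), coeFn_bddMul hψ (y t), coeFn_bddMul (hψ.exp_mul t) (v 0),
    coeFn_bddMul (hφ.exp_mul t) (v 0)] with x g1 g2 g3 g4 g5 g6
  rw [h1, g5, Pi.sub_apply, g3] at g1
  rw [h2, g6, Pi.sub_apply, g4] at g2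
  linear_combination g1 - g2

/-- Exponential decay of the solution of the second-order problem when both characteristic roots
have real part at most `-c`. By Duhamel's formula the solution is
`∫₀ᵗ exp ((t - s) φ + s ψ) v(0) ds`; the bound is independent of how close the roots are. -/
theorem norm_secondOrder_le (hφ : IsBddMeasurable φ) (hψ : IsBddMeasurable ψ)
    {y v v' : ℝ → Lp ℂ 2 μ} (hy : ∀ t, 0 ≤ t → HasDerivAt y (v t) t)
    (hv : ∀ t, 0 ≤ t → HasDerivAt v (v' t) t)
    (hv' : ∀ t, 0 ≤ t → v' t =ᵐ[μ] fun x => (φ x + ψ x) * v t x - φ x * ψ x * y t x)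
    (hy0 : y 0 = 0) {c : ℝ} (hφc : ∀ x, (φ x).re ≤ -c) (hψc : ∀ x, (ψ x).re ≤ -c)
    {t : ℝ} (ht : 0 ≤ t) : ‖y t‖ ≤ t * Real.exp (-c * t) * ‖v 0‖ := by
  have hneg : IsBddMeasurable fun x => (-1 : ℂ) * φ x :=
    IsBddMeasurable.mul ⟨measurable_const, 1, fun x => by simp⟩ hφ
  set g : ℝ → Lp ℂ 2 μ := fun s => bddMul (hφ.exp_mul t) (bddMul (hneg.exp_mul s) (y s)) with hg
  have hder : ∀ s, 0 ≤ s → HasDerivAt g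
      (bddMul (hφ.exp_mul t) (bddMul (hneg.exp_mul s) (v s + bddMul hneg (y s)))) s := fun s hs =>
    (bddMul (hφ.exp_mul t)).hasFDerivAt.comp_hasDerivAt s ((hy s hs).bddMul_exp hneg)
  have hbound : ∀ s ∈ Ico 0 t,
      ‖bddMul (hφ.exp_mul t) (bddMul (hneg.exp_mul s) (v s + bddMul hneg (y s)))‖ ≤
        Real.exp (-c * t) * ‖v 0‖ := fun s hs => by
    have h1 := sub_bddMul_eq_bddMul_exp hφ hψ hy hv hv' hy0 hs.1
    have h2 : v s + bddMul hneg (y s) = bddMul (hψ.exp_mul s) (v 0) := by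
      rw [← h1]
      apply Lp.ext
      filter_upwards [Lp.coeFn_add (v s) (bddMul hneg (y s)), Lp.coeFn_sub (v s) (bddMul hφ (y s)),
        coeFn_bddMul hφ (y s), coeFn_bddMul hneg (y s)] with x g1 g2 g3 g4
      rw [g1, g2, Pi.add_apply, Pi.sub_apply, g3, g4]
      ring
    rw [h2, bddMul_bddMul, bddMul_bddMul]
    refine norm_bddMul_apply_le _ (fun x => ?_) _
    rw [← Complex.exp_add, ← Complex.exp_add, Complex.norm_exp, Real.exp_le_exp]
    have e1 : ((t : ℂ) * φ x + s * (-1 * φ x) + s * ψ x).re =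
        (t - s) * (φ x).re + s * (ψ x).re := by
      simp
      ring
    rw [e1]
    nlinarith [mul_le_mul_of_nonneg_left (hφc x) (sub_nonneg.2 hs.2.le),
      mul_le_mul_of_nonneg_left (hψc x) hs.1]
  have hmv := norm_image_sub_le_of_norm_deriv_right_le_segment (a := 0) (b := t)
    (fun s hs => (hder s hs.1).continuousAt.continuousWithinAt)
    (fun s hs => (hder s hs.1).hasDerivWithinAt) hbound t ⟨ht, le_rfl⟩
  have hg0 : g 0 = 0 := by simp [hg, hy0]
  have hgt : g t = y t := by
    apply Lp.ext
    simp only [hg]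
    filter_upwards [coeFn_bddMul (hφ.exp_mul t) (bddMul (hneg.exp_mul t) (y t)),
      coeFn_bddMul (hneg.exp_mul t) (y t)] with x g1 g2
    rw [g1, g2, ← mul_assoc, ← Complex.exp_add]
    simp
  rw [hg0, hgt, sub_zero, sub_zero] at hmv
  linarith

end Multiplication

/-! ### Characteristic roots -/

/-- The square of the frequency of oscillation at `|ξ| = r`, that is, minus a quarter of the
discriminant of the characteristic polynomial `z² + r² z + r² + m² log (1 + r^{2θ})`. It is
negative for large `r`. -/
noncomputable def freqSq (m θ r : ℝ) : ℝ := r ^ 2 + m ^ 2 * Real.log (1 + r ^ (2 * θ)) - r ^ 4 / 4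

/-- The characteristic roots at `|ξ| = r`, for `σ = 1` and `σ = -1`. Of the two real square roots
one vanishes, so that their combination is a square root of `-freqSq m θ r` for either sign. -/
noncomputable def charRoot (σ m θ r : ℝ) : ℂ :=
  -((r ^ 2 / 2 : ℝ) : ℂ) +
    σ * ((Real.sqrt (-freqSq m θ r) : ℂ) + Real.sqrt (freqSq m θ r) * Complex.I)

theorem charRoot_add (m θ r : ℝ) :
    charRoot 1 m θ r + charRoot (-1) m θ r = ((-r ^ 2 : ℝ) : ℂ) := by
  simp only [charRoot]
  push_cast
  ring

theorem charRoot_mul (m θ r : ℝ) :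
    charRoot 1 m θ r * charRoot (-1) m θ r =
      ((r ^ 2 + m ^ 2 * Real.log (1 + r ^ (2 * θ)) : ℝ) : ℂ) := by
  have hsq : ((Real.sqrt (-freqSq m θ r) : ℂ) + Real.sqrt (freqSq m θ r) * Complex.I) ^ 2 =
      ((-freqSq m θ r : ℝ) : ℂ) := by
    rcases le_total 0 (freqSq m θ r) with h | h
    · rw [Real.sqrt_eq_zero_of_nonpos (neg_nonpos.2 h), Complex.ofReal_zero, zero_add, mul_pow,
        Complex.I_sq, ← Complex.ofReal_pow, Real.sq_sqrt h]
      push_cast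
      ring
    · rw [Real.sqrt_eq_zero_of_nonpos h, Complex.ofReal_zero, zero_mul, add_zero,
        ← Complex.ofReal_pow, Real.sq_sqrt (neg_nonneg.2 h)]
  have hfreq : ((r ^ 2 + m ^ 2 * Real.log (1 + r ^ (2 * θ)) : ℝ) : ℂ) =
      (((r ^ 2 / 2) ^ 2 - (-freqSq m θ r) : ℝ) : ℂ) := by
    congr 1
    simp only [freqSq]
    ring
  rw [hfreq, Complex.ofReal_sub, ← hsq]
  simp only [charRoot]
  push_cast
  ring

theorem charRoot_re_le {σ m θ r : ℝ} (hσ : σ = 1 ∨ σ = -1) (hr : 1 ≤ r) :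
    (charRoot σ m θ r).re ≤ -(1 / 2) := by
  have hre : (charRoot σ m θ r).re = -(r ^ 2 / 2) + σ * Real.sqrt (-freqSq m θ r) := by
    simp only [charRoot, Complex.add_re, Complex.neg_re, Complex.ofReal_re,
      Complex.mul_re, Complex.I_re, Complex.I_im, Complex.ofReal_im]
    ring
  have hlog : 0 ≤ Real.log (1 + r ^ (2 * θ)) :=
    Real.log_nonneg (by linarith [Real.rpow_nonneg (zero_le_one.trans hr) (2 * θ)])
  have hsqrt : Real.sqrt (-freqSq m θ r) ≤ r ^ 2 / 2 - 1 / 2 := by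
    refine Real.sqrt_le_iff.2 ⟨by nlinarith, ?_⟩
    simp only [freqSq]
    nlinarith [mul_nonneg (sq_nonneg m) hlog]
  rw [hre]
  rcases hσ with rfl | rfl
  · linarith
  · nlinarith [Real.sqrt_nonneg (-freqSq m θ r)]

theorem measurable_freqSq (m θ : ℝ) : Measurable (freqSq m θ) := by
  unfold freqSq
  fun_prop

theorem continuousOn_freqSq (m : ℝ) {θ : ℝ} (hθ : 0 < θ) : ContinuousOn (freqSq m θ) (Ici 0) := by
  unfold freqSq
  have h1 : ContinuousOn (fun r : ℝ => 1 + r ^ (2 * θ)) (Ici 0) :=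
    continuousOn_const.add (Real.continuous_rpow_const (by positivity)).continuousOn
  have h2 : ContinuousOn (fun r : ℝ => Real.log (1 + r ^ (2 * θ))) (Ici 0) :=
    h1.log fun r hr => by have := Real.rpow_nonneg (mem_Ici.1 hr) (2 * θ); positivity
  fun_prop

theorem measurable_charRoot (σ m θ : ℝ) : Measurable (charRoot σ m θ) := by
  have := measurable_freqSq m θ
  unfold charRoot
  fun_prop

theorem continuousOn_charRoot (σ m : ℝ) {θ : ℝ} (hθ : 0 < θ) :
    ContinuousOn (charRoot σ m θ) (Ici 0) := by
  have := continuousOn_freqSq m hθ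
  unfold charRoot
  fun_prop

/-! ### Radial symbols cut off to a bounded range of frequencies -/

section Cut

variable {n : ℕ}

open Classical in
/-- The radial function of `ξ` equal to `g (2π|ξ|)` if `2π|ξ| ∈ S`, and to `c` otherwise. -/
noncomputable def radialCut (n : ℕ) (S : Set ℝ) (c : ℂ) (g : ℝ → ℂ) (ξ : EuclideanSpace ℝ (Fin n)) :
    ℂ :=
  if 2 * Real.pi * ‖ξ‖ ∈ S then g (2 * Real.pi * ‖ξ‖) else c

theorem isBddMeasurable_radialCut {S : Set ℝ} (hS : MeasurableSet S) {R : ℝ} (hSR : S ⊆ Icc 0 R)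
    (c : ℂ) {g : ℝ → ℂ} (hg : Measurable g) (hgc : ContinuousOn g (Ici 0)) :
    IsBddMeasurable (radialCut n S c g) := by
  obtain ⟨C, hC⟩ := (isCompact_Icc (a := (0 : ℝ)) (b := R)).exists_bound_of_continuousOn
    (hgc.mono Icc_subset_Ici_self)
  have hnorm : Measurable fun ξ : EuclideanSpace ℝ (Fin n) => 2 * Real.pi * ‖ξ‖ := by fun_prop
  refine ⟨Measurable.ite (hnorm hS) (hg.comp hnorm) measurable_const, max C ‖c‖, fun ξ => ?_⟩
  unfold radialCut
  split_ifs with h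
  · exact (hC _ (hSR h)).trans (le_max_left _ _)
  · exact le_max_right _ _

/-! ### The mild solution in Fourier variables -/

/-- On a bounded range `S` of frequencies the Fourier transform of a mild solution with vanishing
initial position solves the second-order problem whose characteristic roots are `charRoot (±1)`. -/
theorem IsMildSolution.exists_secondOrder {m θ : ℝ} (hθ : 0 < θ) {u₁ : L2 n} {u v : ℝ → L2 n}
    (h : IsMildSolution m θ 0 u₁ u v) {S : Set ℝ} (hS : MeasurableSet S) {R : ℝ}
    (hSR : S ⊆ Icc 0 R) (c : ℂ) :
    ∃ y z z' : ℝ → L2 n, (∀ t, 0 ≤ t → HasDerivAt y (z t) t) ∧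
      (∀ t, 0 ≤ t → HasDerivAt z (z' t) t) ∧
      (∀ t, 0 ≤ t → z' t =ᵐ[volume] fun ξ =>
        (radialCut n S c (charRoot 1 m θ) ξ + radialCut n S c (charRoot (-1) m θ) ξ) * z t ξ -
          radialCut n S c (charRoot 1 m θ) ξ * radialCut n S c (charRoot (-1) m θ) ξ * y t ξ) ∧
      y 0 = 0 ∧
      (∀ t, 0 ≤ t → y t =ᵐ[volume] fun ξ => radialCut n S 0 (fun _ => 1) ξ * (𝓕 (u t) : L2 n) ξ) ∧
      z 0 =ᵐ[volume] fun ξ => radialCut n S 0 (fun _ => 1) ξ * (𝓕 u₁ : L2 n) ξ := by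
  set b : ℝ → ℂ := fun r => ((r ^ 2 + m ^ 2 * Real.log (1 + r ^ (2 * θ)) : ℝ) : ℂ) with hb
  have hbc : ContinuousOn b (Ici 0) := by
    have : b = fun r => charRoot 1 m θ r * charRoot (-1) m θ r := by
      ext r; rw [charRoot_mul]
    rw [this]
    exact (continuousOn_charRoot _ _ hθ).mul (continuousOn_charRoot _ _ hθ)
  have hχ := isBddMeasurable_radialCut (n := n) hS hSR 0 (g := fun _ => 1) measurable_const
    continuousOn_const
  have hA := isBddMeasurable_radialCut (n := n) hS hSR 0 (g := fun r => ((r ^ 2 : ℝ) : ℂ))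
    (by fun_prop) (by fun_prop)
  have hB := isBddMeasurable_radialCut (n := n) hS hSR 0 (g := b) (by fun_prop) hbc
  let F : L2 n →L[ℝ] L2 n := ((Lp.fourierTransformₗᵢ (EuclideanSpace ℝ (Fin n)) ℂ :
    L2 n ≃ₗᵢ[ℂ] L2 n) : L2 n →L[ℂ] L2 n).restrictScalars ℝ
  have hF : ∀ f : L2 n, F f = 𝓕 f := fun f => rfl
  -- Extending `u_t` by a constant to negative times makes all the derivatives two-sided.
  set V : ℝ → L2 n := fun s => v (max s 0) with hV
  have hVc : Continuous V :=
    h.continuous_snd.comp_continuous (by fun_prop) fun s => mem_Ici.2 (le_max_right _ _)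
  set U : ℝ → L2 n := fun t => ∫ s in (0 : ℝ)..t, V s with hU
  have hUd : ∀ t, HasDerivAt U (V t) t := fun t => hVc.integral_hasStrictDerivAt 0 t |>.hasDerivAt
  have hUc : Continuous U := continuous_iff_continuousAt.2 fun t => (hUd t).continuousAt
  set W : ℝ → L2 n := fun t => ∫ s in (0 : ℝ)..t, U s with hW
  have hWd : ∀ t, HasDerivAt W (U t) t := fun t => hUc.integral_hasStrictDerivAt 0 t |>.hasDerivAt
  have hVv : ∀ t, 0 ≤ t → V t = v t := fun t ht => by simp [hV, ht]
  have hintV : ∀ t, 0 ≤ t → U t = ∫ s in (0 : ℝ)..t, v s := fun t ht =>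
    intervalIntegral.integral_congr fun s hs => hVv s (by rw [uIcc_of_le ht] at hs; exact hs.1)
  have hUu : ∀ t, 0 ≤ t → U t = u t := fun t ht => by
    rw [h.eq_fst t ht, hintV t ht, zero_add]
  have hWu : ∀ t, 0 ≤ t → W t = ∫ s in (0 : ℝ)..t, u s := fun t ht =>
    intervalIntegral.integral_congr fun s hs => hUu s (by rw [uIcc_of_le ht] at hs; exact hs.1)
  have hz : ∀ t, 0 ≤ t → bddMul hχ (F u₁) - bddMul hA (F (U t)) - bddMul hB (F (W t)) =
      bddMul hχ (F (V t)) := fun t ht => by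
    obtain ⟨hL, hD, hvt⟩ := h.eq_snd t ht
    have hFv : F (V t) = F u₁ + (F (laplaceOp n ⟨_, hD⟩) -
        ((m : ℂ) ^ 2) • F (logLaplaceOp n θ ⟨_, hL⟩)) := by
      rw [hVv t ht, hvt, map_add, map_sub]
      congr 2
      exact (Lp.fourierTransformₗᵢ (EuclideanSpace ℝ (Fin n)) ℂ).map_smul _ _
    have hFD : F (laplaceOp n ⟨_, hD⟩) =ᵐ[volume] fun ξ =>
        ((-(2 * Real.pi * ‖ξ‖) ^ 2 : ℝ) : ℂ) * F (W t + U t) ξ := by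
      rw [hintV t ht, hWu t ht]
      exact fourier_fourierMul _ _
    have hFL : F (logLaplaceOp n θ ⟨_, hL⟩) =ᵐ[volume] fun ξ =>
        ((Real.log (1 + (2 * Real.pi * ‖ξ‖) ^ (2 * θ)) : ℝ) : ℂ) * F (W t) ξ := by
      rw [hWu t ht]
      exact fourier_fourierMul _ _
    rw [hFv]
    rw [map_add] at hFD
    set D : L2 n := F (laplaceOp n ⟨_, hD⟩)
    set L : L2 n := F (logLaplaceOp n θ ⟨_, hL⟩)
    apply Lp.ext
    filter_upwards [Lp.coeFn_sub (bddMul hχ (F u₁) - bddMul hA (F (U t))) (bddMul hB (F (W t))),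
      Lp.coeFn_sub (bddMul hχ (F u₁)) (bddMul hA (F (U t))), coeFn_bddMul hχ (F u₁),
      coeFn_bddMul hA (F (U t)), coeFn_bddMul hB (F (W t)),
      coeFn_bddMul hχ (F u₁ + (D - ((m : ℂ) ^ 2) • L)),
      Lp.coeFn_add (F u₁) (D - ((m : ℂ) ^ 2) • L), Lp.coeFn_sub D (((m : ℂ) ^ 2) • L),
      Lp.coeFn_smul ((m : ℂ) ^ 2) L, hFD, hFL, Lp.coeFn_add (F (W t)) (F (U t))]
      with ξ h1 h2 h3 h4 h5 h6 h7 h8 h9 h10 h11 h12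
    rw [h1, Pi.sub_apply, h2, Pi.sub_apply, h3, h4, h5, h6, h7, Pi.add_apply, h8, Pi.sub_apply, h9,
      Pi.smul_apply, h10, h11, h12, Pi.add_apply, smul_eq_mul]
    unfold radialCut
    split_ifs
    · simp only [hb]
      push_cast
      ring
    · ring
  refine ⟨fun t => bddMul hχ (F (U t)),
    fun t => bddMul hχ (F u₁) - bddMul hA (F (U t)) - bddMul hB (F (W t)),
    fun t => -bddMul hA (F (V t)) - bddMul hB (F (U t)), fun t ht => ?_, fun t ht => ?_,
    fun t ht => ?_, ?_, fun t ht => ?_, ?_⟩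
  · dsimp only
    rw [hz t ht]
    exact ((bddMul hχ).comp F).hasFDerivAt.comp_hasDerivAt t (hUd t)
  · have h1 := ((bddMul hA).comp F).hasFDerivAt.comp_hasDerivAt t (hUd t)
    have h2 := ((bddMul hB).comp F).hasFDerivAt.comp_hasDerivAt t (hWd t)
    exact (h1.const_sub _).sub h2
  · dsimp only
    rw [hz t ht]
    filter_upwards [Lp.coeFn_sub (-bddMul hA (F (V t))) (bddMul hB (F (U t))),
      Lp.coeFn_neg (bddMul hA (F (V t))), coeFn_bddMul hA (F (V t)), coeFn_bddMul hB (F (U t)),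
      coeFn_bddMul hχ (F (V t)), coeFn_bddMul hχ (F (U t))] with ξ h1 h2 h3 h4 h5 h6
    rw [h1, Pi.sub_apply, h2, Pi.neg_apply, h3, h4, h5, h6]
    unfold radialCut
    split_ifs
    · rw [charRoot_add, charRoot_mul]
      simp only [hb]
      push_cast
      ring
    · ring
  · simp [hU]
  · rw [← hUu t ht]
    exact coeFn_bddMul hχ (F (U t))
  · have h0 : bddMul hχ (F u₁) - bddMul hA (F (U 0)) - bddMul hB (F (W 0)) =
        bddMul hχ (F u₁) := by simp [hU, hW]
    dsimp only
    rw [h0]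
    exact coeFn_bddMul hχ (F u₁)

/-- Closed form of the Fourier transform of a mild solution at frequencies at most one. -/
theorem IsMildSolution.fourier_eq_of_le_one {m θ : ℝ} (hθ : 0 < θ) {u₁ : L2 n} {u v : ℝ → L2 n}
    (h : IsMildSolution m θ 0 u₁ u v)
    (hpos : ∀ r ∈ Ioc (0 : ℝ) 1, 0 < freqSq m θ r) {t : ℝ} (ht : 0 ≤ t) :
    ∀ᵐ ξ : EuclideanSpace ℝ (Fin n), 2 * Real.pi * ‖ξ‖ ∈ Ioc (0 : ℝ) 1 →
      (𝓕 (u t) : L2 n) ξ =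
        ((Real.exp (-((2 * Real.pi * ‖ξ‖) ^ 2 / 2) * t) *
          (Real.sin (Real.sqrt (freqSq m θ (2 * Real.pi * ‖ξ‖)) * t) /
            Real.sqrt (freqSq m θ (2 * Real.pi * ‖ξ‖))) : ℝ) : ℂ) * (𝓕 u₁ : L2 n) ξ := by
  obtain ⟨y, z, z', hy, hz, hz', hy0, hyu, hz0⟩ :=
    h.exists_secondOrder hθ (S := Ioc 0 1) measurableSet_Ioc Ioc_subset_Icc_self 0
  have hφ := isBddMeasurable_radialCut (n := n) (S := Ioc (0 : ℝ) 1) measurableSet_Ioc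
    Ioc_subset_Icc_self 0 (measurable_charRoot 1 m θ) (continuousOn_charRoot 1 m hθ)
  have hψ := isBddMeasurable_radialCut (n := n) (S := Ioc (0 : ℝ) 1) measurableSet_Ioc
    Ioc_subset_Icc_self 0 (measurable_charRoot (-1) m θ) (continuousOn_charRoot (-1) m hθ)
  filter_upwards [sub_mul_secondOrder_eq hφ hψ hy hz hz' hy0 ht, hyu t ht, hz0] with ξ h1 h2 h3 hξ
  rw [h2, h3] at h1
  unfold radialCut at h1
  simp only [hξ, if_true, one_mul] at h1
  set r := 2 * Real.pi * ‖ξ‖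
  have hq := hpos r hξ
  have hω : (Real.sqrt (freqSq m θ r) : ℂ) ≠ 0 := by
    rw [Complex.ofReal_ne_zero]
    exact (Real.sqrt_pos.2 hq).ne'
  have hroot : ∀ σ : ℝ, charRoot σ m θ r =
      -((r ^ 2 / 2 : ℝ) : ℂ) + σ * (Real.sqrt (freqSq m θ r) * Complex.I) := fun σ => by
    rw [charRoot, Real.sqrt_eq_zero_of_nonpos (neg_nonpos.2 hq.le), Complex.ofReal_zero, zero_add]
  rw [hroot, hroot] at h1
  set ω := Real.sqrt (freqSq m θ r)
  have e1 : (t : ℂ) * (-((r ^ 2 / 2 : ℝ) : ℂ) + (1 : ℝ) * (ω * Complex.I)) =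
      ((-(r ^ 2 / 2) * t : ℝ) : ℂ) + ((ω * t : ℝ) : ℂ) * Complex.I := by
    push_cast; ring
  have e2 : (t : ℂ) * (-((r ^ 2 / 2 : ℝ) : ℂ) + (-1 : ℝ) * (ω * Complex.I)) =
      ((-(r ^ 2 / 2) * t : ℝ) : ℂ) + ((-(ω * t) : ℝ) : ℂ) * Complex.I := by
    push_cast; ring
  rw [e1, e2, Complex.exp_add, Complex.exp_add, Complex.exp_mul_I, Complex.exp_mul_I,
    Complex.ofReal_neg (ω * t), Complex.cos_neg, Complex.sin_neg] at h1
  have h2I : (2 * Complex.I * ω : ℂ) ≠ 0 := mul_ne_zero (by simp) hω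
  apply mul_left_cancel₀ h2I
  push_cast at h1 ⊢
  have hcancel : (ω : ℂ) * (Complex.sin (ω * t) / ω) = Complex.sin (ω * t) := by field_simp
  linear_combination h1 -
    2 * Complex.I * Complex.exp (-((r : ℂ) ^ 2 / 2) * t) * (𝓕 u₁ : L2 n) ξ * hcancel

theorem integral_norm_sq_eq (f : L2 n) : ∫ ξ, ‖f ξ‖ ^ 2 = ‖f‖ ^ 2 := by
  have h1 := L2.inner_def (𝕜 := ℂ) f f
  rw [inner_self_eq_norm_sq_to_K] at h1
  have h2 : ∀ ξ, inner ℂ (f ξ) (f ξ) = ((‖f ξ‖ ^ 2 : ℝ) : ℂ) := fun ξ => by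
    rw [inner_self_eq_norm_sq_to_K]; simp
  simp only [h2] at h1
  rw [integral_complex_ofReal] at h1
  apply Complex.ofReal_injective
  rw [← h1]
  simp

theorem integrable_norm_sq (f : L2 n) : Integrable fun ξ => ‖f ξ‖ ^ 2 :=
  (memLp_two_iff_integrable_sq_norm (Lp.aestronglyMeasurable _)).1 (Lp.memLp _)

/-- Frequencies above one contribute an exponentially decaying term. -/
theorem IsMildSolution.integral_fourier_sq_le {m θ : ℝ} (hθ : 0 < θ) {u₁ : L2 n} {u v : ℝ → L2 n}
    (h : IsMildSolution m θ 0 u₁ u v) {t : ℝ} (ht : 0 ≤ t) :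
    ∫ ξ in {ξ : EuclideanSpace ℝ (Fin n) | 1 < 2 * Real.pi * ‖ξ‖}, ‖(𝓕 (u t) : L2 n) ξ‖ ^ 2 ≤
      (t * Real.exp (-(1 / 2) * t) * ‖u₁‖) ^ 2 := by
  have hnorm : Measurable fun ξ : EuclideanSpace ℝ (Fin n) => 2 * Real.pi * ‖ξ‖ := by fun_prop
  set s : ℕ → Set (EuclideanSpace ℝ (Fin n)) := fun N =>
    (fun ξ => 2 * Real.pi * ‖ξ‖) ⁻¹' Ioc (1 : ℝ) N with hs
  have hsU : {ξ : EuclideanSpace ℝ (Fin n) | 1 < 2 * Real.pi * ‖ξ‖} = ⋃ N, s N := by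
    ext ξ
    obtain ⟨N, hN⟩ := exists_nat_ge (2 * Real.pi * ‖ξ‖)
    simp only [mem_ofPred_eq, mem_iUnion, hs, mem_preimage, mem_Ioc]
    exact ⟨fun h => ⟨N, h, hN⟩, fun ⟨_, h, _⟩ => h⟩
  rw [hsU]
  refine le_of_tendsto (tendsto_setIntegral_of_monotone (fun N => hnorm measurableSet_Ioc)
    (fun N M hNM => preimage_mono (Ioc_subset_Ioc_right (by exact_mod_cast hNM)))
    (integrable_norm_sq _).integrableOn) (Eventually.of_forall fun N => ?_)
  have hSN : Ioc (1 : ℝ) N ⊆ Icc 0 (N : ℝ) :=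
    fun r hr => ⟨zero_le_one.trans hr.1.le, hr.2⟩
  obtain ⟨y, z, z', hy, hz, hz', hy0, hyu, hz0⟩ :=
    h.exists_secondOrder hθ (S := Ioc 1 N) measurableSet_Ioc hSN (-1)
  have hφ := isBddMeasurable_radialCut (n := n) measurableSet_Ioc hSN (-1)
    (measurable_charRoot 1 m θ) (continuousOn_charRoot 1 m hθ)
  have hψ := isBddMeasurable_radialCut (n := n) measurableSet_Ioc hSN (-1)
    (measurable_charRoot (-1) m θ) (continuousOn_charRoot (-1) m hθ)
  have hre : ∀ σ : ℝ, σ = 1 ∨ σ = -1 → ∀ ξ,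
      (radialCut n (Ioc (1 : ℝ) N) (-1) (charRoot σ m θ) ξ).re ≤ -(1 / 2) := fun σ hσ ξ => by
    unfold radialCut
    split_ifs with hξ
    · exact charRoot_re_le hσ hξ.1.le
    · norm_num
  have hy_le := norm_secondOrder_le hφ hψ hy hz hz' hy0 (hre 1 (.inl rfl)) (hre (-1) (.inr rfl)) ht
  have hz_le : ‖z 0‖ ≤ ‖u₁‖ := by
    rw [← Lp.norm_fourier_eq u₁]
    refine Lp.norm_le_norm_of_ae_le ?_
    filter_upwards [hz0] with ξ hξ
    rw [hξ]
    unfold radialCut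
    split_ifs <;> simp
  calc ∫ ξ in s N, ‖(𝓕 (u t) : L2 n) ξ‖ ^ 2 = ∫ ξ, ‖y t ξ‖ ^ 2 := by
        rw [← integral_indicator (hnorm measurableSet_Ioc)]
        refine integral_congr_ae ?_
        filter_upwards [hyu t ht] with ξ hξ
        rw [hξ]
        unfold radialCut
        by_cases hmem : 2 * Real.pi * ‖ξ‖ ∈ Ioc (1 : ℝ) N
        · rw [indicator_of_mem (show ξ ∈ s N from hmem), if_pos hmem, one_mul]
        · rw [indicator_of_notMem (show ξ ∉ s N from hmem), if_neg hmem]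
          simp
    _ = ‖y t‖ ^ 2 := integral_norm_sq_eq _
    _ ≤ _ := by
        gcongr
        exact hy_le.trans (by gcongr)

end Cut

/-! ### The Fourier transform on `L¹ ∩ L²` -/

section FourierIntegral

variable {n : ℕ}

/-- On `L¹ ∩ L²` the Plancherel transform is given by the Fourier integral, as both represent the
same tempered distribution. -/
theorem fourier_ae_eq_fourierIntegral {f : L2 n} (hf : Integrable (fun x => f x)) :
    (𝓕 f : L2 n) =ᵐ[volume] 𝓕 (fun x => f x) := by
  have hcont : Continuous (𝓕 (fun x => f x)) :=
    VectorFourier.fourierIntegral_continuous Real.continuous_fourierChar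
      (by exact continuous_inner) hf
  refine ae_eq_of_integral_contDiff_smul_eq
    ((Lp.memLp (𝓕 f : L2 n)).locallyIntegrable (by norm_num)) hcont.locallyIntegrable
    fun g hg hgs => ?_
  have hg1 : HasCompactSupport fun x => (g x : ℂ) := hgs.comp_left (g := fun r : ℝ => (r : ℂ)) rfl
  have hg2 : ContDiff ℝ (⊤ : ℕ∞) fun x => (g x : ℂ) := Complex.ofRealCLM.contDiff.comp hg
  set G : SchwartzMap (EuclideanSpace ℝ (Fin n)) ℂ := hg1.toSchwartzMap hg2 with hG
  have hGg : ∀ x, G x = (g x : ℂ) := fun x => rfl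
  have h1 := congrArg (fun T => T G) (Lp.fourier_toTemperedDistribution_eq f)
  simp only [TemperedDistribution.fourier_apply, Lp.toTemperedDistribution_apply] at h1
  have h2 := VectorFourier.integral_bilin_fourierIntegral_eq_flip (μ := volume) (ν := volume)
    (ContinuousLinearMap.mul ℂ ℂ)
    (L := innerₗ (EuclideanSpace ℝ (Fin n))) Real.continuous_fourierChar
    (by exact continuous_inner) G.integrable hf
  calc ∫ x, g x • (𝓕 f : L2 n) x = ∫ x, G x • (𝓕 f : L2 n) x := by
        simp only [hGg, Complex.real_smul, smul_eq_mul]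
    _ = ∫ x, (𝓕 G) x • f x := h1.symm
    _ = ∫ x, G x • 𝓕 (fun x => f x) x := by
        simpa using! h2
    _ = ∫ x, g x • 𝓕 (fun x => f x) x := by
        simp only [hGg, Complex.real_smul, smul_eq_mul]

theorem norm_fourier_le_l1Norm {f : L2 n} (hf : Integrable (fun x => f x)) :
    ∀ᵐ ξ, ‖(𝓕 f : L2 n) ξ‖ ≤ l1Norm f := by
  filter_upwards [fourier_ae_eq_fourierIntegral hf] with ξ hξ
  rw [hξ]
  exact VectorFourier.norm_fourierIntegral_le_integral_norm _ _ _ _ _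

/-- The Fourier integral is continuous and equals the moment at the origin. -/
theorem exists_moment_le_norm_fourier {f : L2 n} (hf : Integrable (fun x => f x))
    (hP : moment f ≠ 0) :
    ∃ δ : ℝ, 0 < δ ∧ ∀ᵐ ξ : EuclideanSpace ℝ (Fin n), 2 * Real.pi * ‖ξ‖ ≤ δ →
      ‖moment f‖ / 2 ≤ ‖(𝓕 f : L2 n) ξ‖ := by
  have hcont : Continuous (𝓕 (fun x => f x)) :=
    VectorFourier.fourierIntegral_continuous Real.continuous_fourierChar
      (by exact continuous_inner) hf
  have h0 : 𝓕 (fun x => f x) 0 = moment f := by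
    simp [Real.fourier_eq, moment]
  have hev : ∀ᶠ ξ in 𝓝 (0 : EuclideanSpace ℝ (Fin n)), ‖moment f‖ / 2 < ‖𝓕 (fun x => f x) ξ‖ := by
    refine hcont.norm.continuousAt.eventually_const_lt ?_
    change ‖moment f‖ / 2 < ‖𝓕 (fun x => f x) 0‖
    rw [h0]
    exact half_lt_self (norm_pos_iff.2 hP)
  obtain ⟨ε, hε, hball⟩ := Metric.eventually_nhds_iff.1 hev
  refine ⟨ε, hε, ?_⟩
  filter_upwards [fourier_ae_eq_fourierIntegral hf] with ξ hξ hle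
  rw [hξ]
  refine (hball ?_).le
  rw [dist_zero_right]
  rcases (norm_nonneg ξ).eq_or_lt with h | h
  · rwa [← h]
  · nlinarith [Real.pi_gt_three]

/-! ### Radial integration -/

/-- The measure of the unit sphere divided by `(2π)ⁿ`. -/
noncomputable def sphereConst (n : ℕ) : ℝ :=
  n * (volume : Measure (EuclideanSpace ℝ (Fin n))).real (Metric.ball 0 1) * ((2 * Real.pi) ^ n)⁻¹

theorem sphereConst_pos (hn : 1 ≤ n) : 0 < sphereConst n := by
  have h1 : 0 < (volume : Measure (EuclideanSpace ℝ (Fin n))).real (Metric.ball 0 1) :=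
    ENNReal.toReal_pos (Metric.measure_ball_pos _ _ one_pos).ne' measure_ball_lt_top.ne
  have h2 : (0 : ℝ) < n := by exact_mod_cast hn
  unfold sphereConst
  have := Real.pi_pos
  positivity

theorem integral_radial (hn : 1 ≤ n) (g : ℝ → ℝ) :
    ∫ ξ : EuclideanSpace ℝ (Fin n), g (2 * Real.pi * ‖ξ‖) =
      sphereConst n * ∫ r in Ioi (0 : ℝ), r ^ (n - 1) * g r := by
  have : Nonempty (Fin n) := ⟨⟨0, hn⟩⟩
  have h2 : (0 : ℝ) < 2 * Real.pi := by positivity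
  have hscale := integral_comp_mul_left_Ioi (fun r : ℝ => r ^ (n - 1) * g r) 0 h2
  have hpow : ∀ y : ℝ, (2 * Real.pi * y) ^ (n - 1) * g (2 * Real.pi * y) =
      (2 * Real.pi) ^ (n - 1) * (y ^ (n - 1) * g (2 * Real.pi * y)) := fun y => by
    rw [mul_pow, mul_assoc]
  simp only [hpow, mul_zero, smul_eq_mul] at hscale
  rw [integral_const_mul] at hscale
  rw [integral_fun_norm_addHaar volume (fun y => g (2 * Real.pi * y))]
  simp only [finrank_euclideanSpace, Fintype.card_fin, smul_eq_mul, nsmul_eq_mul, sphereConst]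
  have hsplit : (2 * Real.pi) ^ n = (2 * Real.pi) ^ (n - 1) * (2 * Real.pi) := by
    rw [← pow_succ, Nat.sub_add_cancel hn]
  have hI : ∫ y in Ioi (0 : ℝ), y ^ (n - 1) * g (2 * Real.pi * y) =
      ((2 * Real.pi) ^ n)⁻¹ * ∫ r in Ioi (0 : ℝ), r ^ (n - 1) * g r := by
    rw [hsplit, mul_inv, mul_assoc, ← hscale, inv_mul_cancel_left₀ (by positivity)]
  rw [hI]
  ring

theorem integrable_radial_iff (hn : 1 ≤ n) (g : ℝ → ℝ) :
    (Integrable fun ξ : EuclideanSpace ℝ (Fin n) => g (2 * Real.pi * ‖ξ‖)) ↔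
      IntegrableOn (fun r => r ^ (n - 1) * g r) (Ioi (0 : ℝ)) := by
  have : Nonempty (Fin n) := ⟨⟨0, hn⟩⟩
  have h2 : (0 : ℝ) < 2 * Real.pi := by positivity
  rw [integrable_fun_norm_addHaar volume (f := fun y => g (2 * Real.pi * y))]
  have h := integrableOn_Ioi_comp_mul_left_iff (fun r : ℝ => r ^ (n - 1) * g r) 0 h2
  rw [mul_zero] at h
  rw [← h]
  have hpow : ∀ y : ℝ, (2 * Real.pi * y) ^ (n - 1) * g (2 * Real.pi * y) =
      (2 * Real.pi) ^ (n - 1) * (y ^ (n - 1) * g (2 * Real.pi * y)) := fun y => by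
    rw [mul_pow, mul_assoc]
  simp only [hpow]
  simp only [finrank_euclideanSpace, Fintype.card_fin, smul_eq_mul]
  exact (integrable_const_mul_iff (isUnit_iff_ne_zero.2 (by positivity)) _).symm

end FourierIntegral

/-! ### Bounds for the frequency of oscillation -/

section Frequency

variable {m θ r : ℝ}

theorem half_mul_rpow_lt_freqSq (hθ : 0 < θ) (hr : r ∈ Ioc (0 : ℝ) 1) :
    m ^ 2 / 2 * r ^ (2 * θ) < freqSq m θ r := by
  have hx0 : 0 < r ^ (2 * θ) := Real.rpow_pos_of_pos hr.1 _
  have hx1 : r ^ (2 * θ) ≤ 1 := Real.rpow_le_one hr.1.le hr.2 (by positivity)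
  have hlog : r ^ (2 * θ) / 2 ≤ Real.log (1 + r ^ (2 * θ)) := by
    have h1 := Real.one_sub_inv_le_log_of_pos (show 0 < 1 + r ^ (2 * θ) by positivity)
    refine le_trans ?_ h1
    rw [show 1 - (1 + r ^ (2 * θ))⁻¹ = r ^ (2 * θ) / (1 + r ^ (2 * θ)) by field_simp; ring]
    exact div_le_div_of_nonneg_left hx0.le (by positivity) (by linarith)
  have hr2 : 0 < r ^ 2 := pow_pos hr.1 2
  have hr2' : r ^ 2 ≤ 1 := pow_le_one₀ hr.1.le hr.2
  have hr4 : r ^ 4 ≤ r ^ 2 := by nlinarith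
  unfold freqSq
  nlinarith [mul_le_mul_of_nonneg_left hlog (sq_nonneg m)]

theorem freqSq_pos (hθ : 0 < θ) (hr : r ∈ Ioc (0 : ℝ) 1) : 0 < freqSq m θ r :=
  lt_of_le_of_lt (mul_nonneg (by positivity) (Real.rpow_nonneg hr.1.le _))
    (half_mul_rpow_lt_freqSq hθ hr)

theorem freqSq_le (hθ1 : θ ≤ 1) (hr : r ∈ Ioc (0 : ℝ) 1) :
    freqSq m θ r ≤ (1 + m ^ 2) * r ^ (2 * θ) := by
  have hx0 : 0 < r ^ (2 * θ) := Real.rpow_pos_of_pos hr.1 _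
  have hlog : Real.log (1 + r ^ (2 * θ)) ≤ r ^ (2 * θ) := by
    have := Real.log_le_sub_one_of_pos (show 0 < 1 + r ^ (2 * θ) by positivity)
    linarith
  have hpow : r ^ 2 ≤ r ^ (2 * θ) := by
    rw [← Real.rpow_natCast r 2]
    exact Real.rpow_le_rpow_of_exponent_ge hr.1 hr.2 (by push_cast; linarith)
  have hr4 : 0 ≤ r ^ 4 := by positivity
  unfold freqSq
  nlinarith [mul_le_mul_of_nonneg_left hlog (sq_nonneg m)]

theorem hasDerivAt_freqSq (hr : 0 < r) :
    HasDerivAt (freqSq m θ)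
      (2 * r + m ^ 2 * (2 * θ * r ^ (2 * θ - 1) / (1 + r ^ (2 * θ))) - r ^ 3) r := by
  have hx0 : 0 < r ^ (2 * θ) := Real.rpow_pos_of_pos hr _
  have h1 : HasDerivAt (fun r : ℝ => 1 + r ^ (2 * θ)) (2 * θ * r ^ (2 * θ - 1)) r :=
    (Real.hasDerivAt_rpow_const (Or.inl hr.ne')).const_add 1
  have h2 := ((hasDerivAt_pow 2 r).add ((h1.log (by positivity)).const_mul (m ^ 2))).sub
    ((hasDerivAt_pow 4 r).div_const 4)
  convert! h2 using 1
  norm_num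

/-- The derivative of the frequency is nonnegative and at most `(1 + m²) r^{2θ-1}` divided by the
frequency. -/
theorem hasDerivAt_sqrt_freqSq (hθ : 0 < θ) (hθ1 : θ ≤ 1) (hr : r ∈ Ioc (0 : ℝ) 1) :
    ∃ d : ℝ, HasDerivAt (fun r => Real.sqrt (freqSq m θ r)) d r ∧ 0 ≤ d ∧
      d ≤ (1 + m ^ 2) * r ^ (2 * θ - 1) / Real.sqrt (freqSq m θ r) := by
  have hq := freqSq_pos (m := m) hθ hr
  have hω := Real.sqrt_pos.2 hq
  have hx0 : 0 < r ^ (2 * θ) := Real.rpow_pos_of_pos hr.1 _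
  have hy0 : 0 < r ^ (2 * θ - 1) := Real.rpow_pos_of_pos hr.1 _
  have hpow : r ≤ r ^ (2 * θ - 1) := by
    conv_lhs => rw [← Real.rpow_one r]
    exact Real.rpow_le_rpow_of_exponent_ge hr.1 hr.2 (by linarith)
  have hfrac0 : 0 ≤ 2 * θ * r ^ (2 * θ - 1) / (1 + r ^ (2 * θ)) := by positivity
  have hfrac1 : 2 * θ * r ^ (2 * θ - 1) / (1 + r ^ (2 * θ)) ≤ 2 * r ^ (2 * θ - 1) := by
    rw [div_le_iff₀ (by positivity)]
    nlinarith [mul_pos hy0 hx0]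
  have hr3 : r ^ 3 ≤ 2 * r := by nlinarith [hr.1, hr.2, mul_pos hr.1 hr.1]
  have hr3' : 0 < r ^ 3 := pow_pos hr.1 3
  refine ⟨_, (hasDerivAt_freqSq (m := m) (θ := θ) hr.1).sqrt hq.ne', ?_, ?_⟩
  · have := mul_nonneg (sq_nonneg m) hfrac0
    exact div_nonneg (by linarith) (by positivity)
  · have := mul_le_mul_of_nonneg_left hfrac1 (sq_nonneg m)
    rw [div_le_div_iff₀ (by positivity) hω]
    nlinarith

end Frequency

/-! ### The radial profile of the solution -/

/-- The factor by which the initial velocity is multiplied at frequency `|ξ| = r ≤ 1`. -/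
noncomputable def waveKernel (m θ t r : ℝ) : ℝ :=
  Real.exp (-(r ^ 2 / 2) * t) *
    (Real.sin (Real.sqrt (freqSq m θ r) * t) / Real.sqrt (freqSq m θ r))

section Kernel

variable {m θ t : ℝ}

theorem waveKernel_sq (m θ t r : ℝ) :
    waveKernel m θ t r ^ 2 = Real.exp (-(r ^ 2 * t)) *
      (Real.sin (Real.sqrt (freqSq m θ r) * t) / Real.sqrt (freqSq m θ r)) ^ 2 := by
  rw [waveKernel, mul_pow, ← Real.exp_nat_mul]
  congr 2
  push_cast
  ring

theorem measurable_waveKernel (m θ t : ℝ) : Measurable (waveKernel m θ t) := by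
  have := measurable_freqSq m θ
  unfold waveKernel
  fun_prop

theorem waveKernel_sq_le_sq (ht : 0 ≤ t) (r : ℝ) : waveKernel m θ t r ^ 2 ≤ t ^ 2 := by
  rw [waveKernel_sq]
  have hexp : Real.exp (-(r ^ 2 * t)) ≤ 1 := Real.exp_le_one_iff.2 (by nlinarith [sq_nonneg r])
  have hsin : |Real.sin (Real.sqrt (freqSq m θ r) * t) / Real.sqrt (freqSq m θ r)| ≤ t := by
    rw [abs_div, abs_of_nonneg (Real.sqrt_nonneg _)]
    refine div_le_of_le_mul₀ (Real.sqrt_nonneg _) ht ?_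
    refine Real.abs_sin_le_abs.trans ?_
    rw [abs_of_nonneg (mul_nonneg (Real.sqrt_nonneg _) ht), mul_comm]
  calc _ ≤ 1 * (Real.sin (Real.sqrt (freqSq m θ r) * t) / Real.sqrt (freqSq m θ r)) ^ 2 := by
        gcongr
    _ ≤ t ^ 2 := by
        rw [one_mul, ← sq_abs]
        gcongr

theorem waveKernel_sq_le (hθ : 0 < θ) (hm : 0 < m) {r : ℝ} (hr : r ∈ Ioc (0 : ℝ) 1) :
    waveKernel m θ t r ^ 2 ≤ 2 / m ^ 2 * r ^ (-(2 * θ)) * Real.exp (-(r ^ 2 * t)) := by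
  have hq := freqSq_pos (m := m) hθ hr
  have hx0 : 0 < r ^ (2 * θ) := Real.rpow_pos_of_pos hr.1 _
  rw [waveKernel_sq, div_pow, Real.sq_sqrt hq.le, mul_comm]
  gcongr
  rw [Real.rpow_neg hr.1.le, div_le_iff₀ hq]
  have h1 := half_mul_rpow_lt_freqSq (m := m) hθ hr
  calc _ ≤ (1 : ℝ) := Real.sin_sq_le_one _
    _ = 2 / m ^ 2 * (r ^ (2 * θ))⁻¹ * (m ^ 2 / 2 * r ^ (2 * θ)) := by field_simp
    _ ≤ _ := by gcongr

theorem integrableOn_pow_mul_waveKernel_sq (n : ℕ) (ht : 0 ≤ t) :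
    IntegrableOn (fun r => r ^ (n - 1) * waveKernel m θ t r ^ 2) (Ioc 0 1) := by
  have hmeas : Measurable fun r : ℝ => r ^ (n - 1) * waveKernel m θ t r ^ 2 := by
    have := measurable_waveKernel m θ t
    fun_prop
  refine Measure.integrableOn_of_bounded (M := t ^ 2) (by simp) hmeas.aestronglyMeasurable ?_
  filter_upwards [ae_restrict_mem measurableSet_Ioc] with r hr
  rw [norm_mul, norm_pow, Real.norm_of_nonneg hr.1.le, Real.norm_of_nonneg (sq_nonneg _)]
  calc r ^ (n - 1) * waveKernel m θ t r ^ 2 ≤ 1 * t ^ 2 :=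
        mul_le_mul (pow_le_one₀ hr.1.le hr.2) (waveKernel_sq_le_sq ht r) (sq_nonneg _) zero_le_one
    _ = t ^ 2 := one_mul _

/-! ### Upper bounds for the radial integral -/

/-- Without oscillation: the Gaussian factor alone gives the decay when `r^{n-1-2θ}` is integrable
at the origin. -/
theorem integral_waveKernel_sq_le_rpow {n : ℕ} (hn : 1 ≤ n) (hθ : 0 < θ) (hm : 0 < m)
    (hnθ : 2 * θ < n) (ht : 0 < t) :
    ∫ r in Ioc (0 : ℝ) 1, r ^ (n - 1) * waveKernel m θ t r ^ 2 ≤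
      Real.Gamma ((n - 2 * θ) / 2) / m ^ 2 * t ^ (-((n - 2 * θ) / 2)) := by
  have hpow : ∀ r : ℝ, 0 < r → r ^ (n - 1) * r ^ (-(2 * θ)) = r ^ ((n : ℝ) - 1 - 2 * θ) :=
    fun r hr => by
      rw [← Real.rpow_natCast, ← Real.rpow_add hr, Nat.cast_sub hn]
      congr 1
      push_cast
      ring
  have hgauss := integral_rpow_mul_exp_neg_mul_rpow (p := 2) (q := (n : ℝ) - 1 - 2 * θ) (b := t)
    two_pos (by linarith) ht
  have hint : IntegrableOn (fun r : ℝ => r ^ ((n : ℝ) - 1 - 2 * θ) * Real.exp (-t * r ^ (2 : ℝ)))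
      (Ioi 0) := integrableOn_rpow_mul_exp_neg_mul_rpow (by linarith) two_pos ht
  calc ∫ r in Ioc (0 : ℝ) 1, r ^ (n - 1) * waveKernel m θ t r ^ 2
      ≤ ∫ r in Ioc (0 : ℝ) 1,
          2 / m ^ 2 * (r ^ ((n : ℝ) - 1 - 2 * θ) * Real.exp (-t * r ^ (2 : ℝ))) := by
        refine setIntegral_mono_on (integrableOn_pow_mul_waveKernel_sq n ht.le)
          ((hint.mono_set Ioc_subset_Ioi_self).const_mul _) measurableSet_Ioc fun r hr => ?_
        rw [← hpow r hr.1, Real.rpow_two]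
        calc _ ≤ r ^ (n - 1) * (2 / m ^ 2 * r ^ (-(2 * θ)) * Real.exp (-(r ^ 2 * t))) :=
              mul_le_mul_of_nonneg_left (waveKernel_sq_le hθ hm hr) (pow_nonneg hr.1.le _)
          _ = _ := by
              rw [show -(r ^ 2 * t) = -t * r ^ 2 by ring]
              ring
    _ = 2 / m ^ 2 * ∫ r in Ioc (0 : ℝ) 1,
          r ^ ((n : ℝ) - 1 - 2 * θ) * Real.exp (-t * r ^ (2 : ℝ)) := integral_const_mul _ _
    _ ≤ 2 / m ^ 2 * ∫ r in Ioi (0 : ℝ),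
          r ^ ((n : ℝ) - 1 - 2 * θ) * Real.exp (-t * r ^ (2 : ℝ)) := by
        refine mul_le_mul_of_nonneg_left
          (setIntegral_mono_set hint ?_ Ioc_subset_Ioi_self.eventuallyLE) (by positivity)
        filter_upwards [ae_restrict_mem measurableSet_Ioi] with r hr
        exact mul_nonneg (Real.rpow_nonneg (le_of_lt hr) _) (Real.exp_nonneg _)
    _ = _ := by
        rw [hgauss, show (n : ℝ) - 1 - 2 * θ + 1 = n - 2 * θ by ring,
          show -((n : ℝ) - 2 * θ) / 2 = -((n - 2 * θ) / 2) by ring]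
        ring

/-- The kernel is bounded by `t` below the frequency `ρ` and by the inverse of the frequency of
oscillation above. -/
theorem integral_waveKernel_sq_le_split {n : ℕ} (hn : 1 ≤ n) (hθ : 0 < θ) (hm : 0 < m)
    (ht : 0 ≤ t) {ρ : ℝ} (hρ : ρ ∈ Ioc (0 : ℝ) 1) :
    ∫ r in Ioc (0 : ℝ) 1, r ^ (n - 1) * waveKernel m θ t r ^ 2 ≤
      t ^ 2 * ρ ^ n + 2 / m ^ 2 * ∫ r in ρ..1, r ^ ((n : ℝ) - 1 - 2 * θ) := by
  have hint := integrableOn_pow_mul_waveKernel_sq (m := m) (θ := θ) n ht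
  have hint1 := hint.mono_set (Ioc_subset_Ioc_right hρ.2)
  have hint2 := hint.mono_set (Ioc_subset_Ioc_left hρ.1.le)
  have hrpow : IntegrableOn (fun r : ℝ => 2 / m ^ 2 * r ^ ((n : ℝ) - 1 - 2 * θ)) (Ioc ρ 1) := by
    refine Integrable.const_mul (IntegrableOn.integrable ?_) _
    refine (ContinuousOn.integrableOn_Icc ?_).mono_set Ioc_subset_Icc_self
    exact fun r hr => (Real.continuousAt_rpow_const _ _
      (Or.inl (hρ.1.trans_le hr.1).ne')).continuousWithinAt
  rw [← Ioc_union_Ioc_eq_Ioc hρ.1.le hρ.2, setIntegral_union (Ioc_disjoint_Ioc_of_le le_rfl)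
    measurableSet_Ioc hint1 hint2]
  refine add_le_add ?_ ?_
  · calc _ ≤ ∫ r in Ioc (0 : ℝ) ρ, ρ ^ (n - 1) * t ^ 2 := by
          refine setIntegral_mono_on hint1 (integrableOn_const (by simp)) measurableSet_Ioc
            fun r hr => ?_
          exact mul_le_mul (pow_le_pow_left₀ hr.1.le hr.2 _) (waveKernel_sq_le_sq ht r)
            (sq_nonneg _) (pow_nonneg hρ.1.le _)
      _ = t ^ 2 * ρ ^ n := by
          obtain ⟨k, rfl⟩ : ∃ k, n = k + 1 := ⟨n - 1, by omega⟩
          simp [hρ.1.le]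
          ring
  · rw [intervalIntegral.integral_of_le hρ.2, ← integral_const_mul]
    refine setIntegral_mono_on hint2 hrpow measurableSet_Ioc fun r hr => ?_
    have hr' : r ∈ Ioc (0 : ℝ) 1 := ⟨hρ.1.trans hr.1, hr.2⟩
    have hexp : Real.exp (-(r ^ 2 * t)) ≤ 1 := Real.exp_le_one_iff.2 (by nlinarith [sq_nonneg r])
    have hpow : r ^ (n - 1) * r ^ (-(2 * θ)) = r ^ ((n : ℝ) - 1 - 2 * θ) := by
      rw [← Real.rpow_natCast, ← Real.rpow_add hr'.1, Nat.cast_sub hn]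
      congr 1
      push_cast
      ring
    have hx : 0 ≤ r ^ (-(2 * θ)) := Real.rpow_nonneg hr'.1.le _
    rw [← hpow]
    calc _ ≤ r ^ (n - 1) * (2 / m ^ 2 * r ^ (-(2 * θ)) * Real.exp (-(r ^ 2 * t))) :=
          mul_le_mul_of_nonneg_left (waveKernel_sq_le hθ hm hr') (pow_nonneg hr'.1.le _)
      _ ≤ r ^ (n - 1) * (2 / m ^ 2 * r ^ (-(2 * θ)) * 1) := by
          have := pow_nonneg hr'.1.le (n - 1)
          gcongr
      _ = _ := by ring

theorem integral_waveKernel_sq_le_growth (hθ : 1 / 2 < θ) (hm : 0 < m) (ht : 1 ≤ t) :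
    ∫ r in Ioc (0 : ℝ) 1, r ^ (1 - 1) * waveKernel m θ t r ^ 2 ≤
      (1 + 2 / (m ^ 2 * (2 * θ - 1))) * t ^ ((2 * θ - 1) / θ) := by
  have ht0 : 0 < t := one_pos.trans_le ht
  have hθ0 : 0 < θ := by linarith
  -- The threshold balances the two bounds `t` and `r^{-θ}` for the kernel.
  set ρ : ℝ := t ^ (-(1 / θ)) with hρdef
  have hρ : ρ ∈ Ioc (0 : ℝ) 1 :=
    ⟨Real.rpow_pos_of_pos ht0 _, Real.rpow_le_one_of_one_le_of_nonpos ht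
      (neg_nonpos.2 (by positivity))⟩
  have h := integral_waveKernel_sq_le_split (n := 1) (m := m) le_rfl hθ0 hm ht0.le hρ
  have h0 : (0 : ℝ) ∉ uIcc ρ 1 := by
    rw [uIcc_of_le hρ.2]
    exact fun h => absurd h.1 (not_le.2 hρ.1)
  rw [integral_rpow (Or.inr ⟨by push_cast; linarith, h0⟩)] at h
  have e1 : t ^ 2 * ρ ^ 1 = t ^ ((2 * θ - 1) / θ) := by
    rw [pow_one, hρdef, ← Real.rpow_natCast, ← Real.rpow_add ht0]
    congr 1
    push_cast
    field_simp
    ring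
  have e2 : ρ ^ (1 - 2 * θ) = t ^ ((2 * θ - 1) / θ) := by
    rw [hρdef, ← Real.rpow_mul ht0.le]
    congr 1
    field_simp
    ring
  rw [e1, Nat.cast_one, show (1 : ℝ) - 1 - 2 * θ + 1 = 1 - 2 * θ by ring, Real.one_rpow, e2] at h
  refine h.trans ?_
  have hd : 0 < 2 * θ - 1 := by linarith
  have e3 : 2 / m ^ 2 * ((1 - t ^ ((2 * θ - 1) / θ)) / (1 - 2 * θ)) =
      2 / (m ^ 2 * (2 * θ - 1)) * (t ^ ((2 * θ - 1) / θ) - 1) := by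
    rw [show 1 - 2 * θ = -(2 * θ - 1) by ring]
    field_simp
    ring
  rw [e3]
  have : 0 < 2 / (m ^ 2 * (2 * θ - 1)) := by positivity
  linarith

theorem integral_waveKernel_sq_le_log {n : ℕ} (hn : 1 ≤ n) (hnθ : (n : ℝ) = 2 * θ) (hm : 0 < m)
    (ht : 1 ≤ t) :
    ∫ r in Ioc (0 : ℝ) 1, r ^ (n - 1) * waveKernel m θ t r ^ 2 ≤
      1 + 2 / (m ^ 2 * θ) * Real.log t := by
  have ht0 : 0 < t := one_pos.trans_le ht
  have hθ0 : 0 < θ := by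
    have : (1 : ℝ) ≤ n := by exact_mod_cast hn
    linarith
  set ρ : ℝ := t ^ (-(1 / θ)) with hρdef
  have hρ : ρ ∈ Ioc (0 : ℝ) 1 :=
    ⟨Real.rpow_pos_of_pos ht0 _, Real.rpow_le_one_of_one_le_of_nonpos ht
      (neg_nonpos.2 (by positivity))⟩
  have h := integral_waveKernel_sq_le_split (m := m) hn hθ0 hm ht0.le hρ
  have e1 : t ^ 2 * ρ ^ n = 1 := by
    rw [hρdef, ← Real.rpow_natCast, ← Real.rpow_natCast, ← Real.rpow_mul ht0.le,
      ← Real.rpow_add ht0, hnθ]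
    convert! Real.rpow_zero t using 2
    push_cast
    field_simp
    ring
  have e2 : ∫ r in ρ..1, r ^ ((n : ℝ) - 1 - 2 * θ) = 1 / θ * Real.log t := by
    rw [show (n : ℝ) - 1 - 2 * θ = -1 by rw [hnθ]; ring]
    simp only [Real.rpow_neg_one]
    rw [integral_inv_of_pos hρ.1 one_pos, Real.log_div one_ne_zero hρ.1.ne', Real.log_one, hρdef,
      Real.log_rpow ht0]
    ring
  rw [e1, e2] at h
  refine h.trans (le_of_eq ?_)
  field_simp

end Kernel

/-! ### Lower bounds for the radial integral -/

section Lower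

variable {m θ t : ℝ}

/-- An explicit function whose derivative is at most `sin² (w t) / w`: averaging `sin²` to `1/2`
gives the logarithm, and the remaining terms, of size `1 / (t w)`, account for the oscillation. -/
theorem hasDerivAt_oscillation (ht : 0 < t) {w : ℝ} (hw : 0 < w) :
    ∃ d : ℝ, HasDerivAt (fun w => Real.log w / 2 - Real.sin (2 * (w * t)) / (4 * t * w) +
      1 / (4 * t * w)) d w ∧ d ≤ Real.sin (w * t) ^ 2 / w := by
  have h1 : HasDerivAt (fun w => Real.sin (2 * (w * t)))
      (Real.cos (2 * (w * t)) * (2 * (1 * t))) w :=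
    (((hasDerivAt_id w).mul_const t).const_mul 2).sin
  have h2 : HasDerivAt (fun w => 4 * t * w) (4 * t * 1) w := (hasDerivAt_id w).const_mul (4 * t)
  have h3 : 4 * t * w ≠ 0 := by positivity
  refine ⟨_, (((Real.hasDerivAt_log hw.ne').div_const 2).sub (h1.div h2 h3)).add
    ((hasDerivAt_const w (1 : ℝ)).div h2 h3), ?_⟩
  have hcos : Real.sin (w * t) ^ 2 = 1 / 2 - Real.cos (2 * (w * t)) / 2 := by
    rw [Real.sin_sq_eq_half_sub]
  have hsin := Real.sin_le_one (2 * (w * t))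
  have key : Real.sin (w * t) ^ 2 / w -
      (w⁻¹ / 2 - (Real.cos (2 * (w * t)) * (2 * (1 * t)) * (4 * t * w) -
        Real.sin (2 * (w * t)) * (4 * t * 1)) / (4 * t * w) ^ 2 +
        (0 * (4 * t * w) - 1 * (4 * t * 1)) / (4 * t * w) ^ 2) =
      (1 - Real.sin (2 * (w * t))) / (4 * t * w ^ 2) := by
    rw [hcos]
    field_simp
    ring
  have : 0 ≤ (1 - Real.sin (2 * (w * t))) / (4 * t * w ^ 2) :=
    div_nonneg (by linarith) (by positivity)
  linarith

/-- With the frequency of oscillation `ω` as the variable of integration the radial integral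
dominates `∫ sin² (ω t) / ω dω`, which is half the logarithm of the ratio of the end points up to
an error that tends to zero. -/
theorem le_integral_waveKernel_sq {n : ℕ} (hn : 1 ≤ n) (hθ : 0 < θ) (hθ1 : θ ≤ 1) (hm : 0 < m)
    (hnθ : 2 * θ ≤ n) (ht : 0 < t) {a b : ℝ} (ha : 0 < a) (hab : a ≤ b) (hb : b ≤ 1) :
    Real.exp (-(b ^ 2 * t)) * (a ^ ((n : ℝ) - 2 * θ) / (1 + m ^ 2)) *
        (Real.log (m ^ 2 / (2 * (1 + m ^ 2)) * (b / a) ^ (2 * θ)) / 4 - 1 / (m * (t * a ^ θ))) ≤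
      ∫ r in Ioc a b, r ^ (n - 1) * waveKernel m θ t r ^ 2 := by
  set ω : ℝ → ℝ := fun r => Real.sqrt (freqSq m θ r) with hω
  have hmem : ∀ r ∈ Icc a b, r ∈ Ioc (0 : ℝ) 1 := fun r hr => ⟨ha.trans_le hr.1, hr.2.trans hb⟩
  have hωpos : ∀ r ∈ Icc a b, 0 < ω r := fun r hr => Real.sqrt_pos.2 (freqSq_pos hθ (hmem r hr))
  have hωc : ContinuousOn ω (Icc a b) :=
    ((continuousOn_freqSq m hθ).mono fun r hr => (hmem r hr).1.le).sqrt
  set H : ℝ → ℝ := fun w => Real.log w / 2 - Real.sin (2 * (w * t)) / (4 * t * w) +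
    1 / (4 * t * w) with hH
  have hder : ∀ r ∈ Icc a b, ∃ d : ℝ, HasDerivAt (fun r => H (ω r)) d r ∧
      d ≤ (1 + m ^ 2) / a ^ ((n : ℝ) - 2 * θ) *
        (r ^ (n - 1) * (Real.sin (ω r * t) / ω r) ^ 2) := fun r hr => by
    obtain ⟨d, hd, hd0, hd1⟩ := hasDerivAt_sqrt_freqSq (m := m) hθ hθ1 (hmem r hr)
    obtain ⟨e, he, he1⟩ := hasDerivAt_oscillation ht (hωpos r hr)
    have hr0 := (hmem r hr).1
    have hw := hωpos r hr
    have hapos : 0 < a ^ ((n : ℝ) - 2 * θ) := Real.rpow_pos_of_pos ha _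
    refine ⟨_, he.comp r hd, ?_⟩
    have hpow : r ^ (2 * θ - 1) ≤ r ^ (n - 1) / a ^ ((n : ℝ) - 2 * θ) := by
      rw [le_div_iff₀ hapos]
      calc r ^ (2 * θ - 1) * a ^ ((n : ℝ) - 2 * θ)
          ≤ r ^ (2 * θ - 1) * r ^ ((n : ℝ) - 2 * θ) := by
            exact mul_le_mul_of_nonneg_left
              (Real.rpow_le_rpow ha.le hr.1 (sub_nonneg.2 hnθ)) (Real.rpow_nonneg hr0.le _)
        _ = r ^ (n - 1) := by
            rw [← Real.rpow_natCast, ← Real.rpow_add hr0, Nat.cast_sub hn]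
            congr 1
            push_cast
            ring
    calc e * d ≤ Real.sin (ω r * t) ^ 2 / ω r * d := mul_le_mul_of_nonneg_right he1 hd0
      _ ≤ Real.sin (ω r * t) ^ 2 / ω r *
            ((1 + m ^ 2) * (r ^ (n - 1) / a ^ ((n : ℝ) - 2 * θ)) / ω r) := by
          refine mul_le_mul_of_nonneg_left (hd1.trans ?_) (by positivity)
          exact div_le_div_of_nonneg_right (by gcongr) hw.le
      _ = _ := by
          field_simp
  choose! d hd hd1 using hder
  have hφc : ContinuousOn (fun r => (1 + m ^ 2) / a ^ ((n : ℝ) - 2 * θ) *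
      (r ^ (n - 1) * (Real.sin (ω r * t) / ω r) ^ 2)) (Icc a b) := by
    have h1 : ContinuousOn (fun r => Real.sin (ω r * t) / ω r) (Icc a b) :=
      ((Real.continuous_sin.comp_continuousOn (hωc.mul continuousOn_const))).div hωc
        fun r hr => (hωpos r hr).ne'
    fun_prop
  have hFTC := intervalIntegral.sub_le_integral_of_hasDeriv_right_of_le hab
    (fun r hr => (hd r hr).continuousAt.continuousWithinAt)
    (fun r hr => (hd r (Ioo_subset_Icc_self hr)).hasDerivWithinAt)
    hφc.integrableOn_Icc (fun r hr => hd1 r (Ioo_subset_Icc_self hr))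
  rw [intervalIntegral.integral_const_mul, intervalIntegral.integral_of_le hab] at hFTC
  have hapos : 0 < a ^ ((n : ℝ) - 2 * θ) := Real.rpow_pos_of_pos ha _
  have haθ : 0 < a ^ θ := Real.rpow_pos_of_pos ha _
  have hamem : a ∈ Icc a b := ⟨le_rfl, hab⟩
  have hbmem : b ∈ Icc a b := ⟨hab, le_rfl⟩
  have hb0 : 0 < b := ha.trans_le hab
  have hb2θ : 0 < b ^ (2 * θ) := Real.rpow_pos_of_pos hb0 _
  have ha2θ : 0 < a ^ (2 * θ) := Real.rpow_pos_of_pos ha _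
  have hqa := freqSq_pos (m := m) hθ (hmem a hamem)
  have hqb := freqSq_pos (m := m) hθ (hmem b hbmem)
  have hlog : Real.log (m ^ 2 / (2 * (1 + m ^ 2)) * (b / a) ^ (2 * θ)) / 2 ≤
      Real.log (ω b) - Real.log (ω a) := by
    rw [hω, Real.log_sqrt hqb.le, Real.log_sqrt hqa.le, ← sub_div, ← Real.log_div hqb.ne' hqa.ne']
    gcongr
    rw [Real.div_rpow hb0.le ha.le]
    calc m ^ 2 / (2 * (1 + m ^ 2)) * (b ^ (2 * θ) / a ^ (2 * θ)) =
          (m ^ 2 / 2 * b ^ (2 * θ)) / ((1 + m ^ 2) * a ^ (2 * θ)) := by field_simp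
      _ ≤ _ := div_le_div₀ hqb.le (half_mul_rpow_lt_freqSq hθ (hmem b hbmem)).le hqa
            (freqSq_le hθ1 (hmem a hamem))
  have hωa : m * a ^ θ / 2 ≤ ω a := by
    refine Real.le_sqrt_of_sq_le ?_
    have h1 := (half_mul_rpow_lt_freqSq (m := m) hθ (hmem a hamem)).le
    have h2 : (a ^ θ) ^ 2 = a ^ (2 * θ) := by
      rw [← Real.rpow_natCast, ← Real.rpow_mul ha.le]
      congr 1
      push_cast
      ring
    rw [div_pow, mul_pow, h2]
    have : 0 ≤ m ^ 2 * a ^ (2 * θ) := by positivity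
    linarith
  have hHb : Real.log (ω b) / 2 ≤ H (ω b) := by
    have hwb := hωpos b hbmem
    have h1 : 0 ≤ (1 - Real.sin (2 * (ω b * t))) / (4 * t * ω b) :=
      div_nonneg (by linarith [Real.sin_le_one (2 * (ω b * t))]) (by positivity)
    rw [sub_div] at h1
    simp only [hH]
    linarith
  have hHa : H (ω a) ≤ Real.log (ω a) / 2 + 1 / (m * (t * a ^ θ)) := by
    have hwa := hωpos a hamem
    have h1 : (1 - Real.sin (2 * (ω a * t))) / (4 * t * ω a) ≤ 1 / (m * (t * a ^ θ)) := by
      rw [div_le_div_iff₀ (by positivity) (by positivity)]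
      have h2 : 1 - Real.sin (2 * (ω a * t)) ≤ 2 := by
        linarith [Real.neg_one_le_sin (2 * (ω a * t))]
      have h3 : 0 < m * (t * a ^ θ) := by positivity
      nlinarith [mul_le_mul_of_nonneg_left hωa ht.le]
    rw [sub_div] at h1
    simp only [hH]
    linarith
  have hmain : Real.log (m ^ 2 / (2 * (1 + m ^ 2)) * (b / a) ^ (2 * θ)) / 4 -
      1 / (m * (t * a ^ θ)) ≤ (1 + m ^ 2) / a ^ ((n : ℝ) - 2 * θ) *
        ∫ r in Ioc a b, r ^ (n - 1) * (Real.sin (ω r * t) / ω r) ^ 2 := by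
    linarith
  have hint : IntegrableOn (fun r => r ^ (n - 1) * (Real.sin (ω r * t) / ω r) ^ 2) (Ioc a b) := by
    have h1 : ContinuousOn (fun r => Real.sin (ω r * t) / ω r) (Icc a b) :=
      ((Real.continuous_sin.comp_continuousOn (hωc.mul continuousOn_const))).div hωc
        fun r hr => (hωpos r hr).ne'
    have h2 : ContinuousOn (fun r => r ^ (n - 1) * (Real.sin (ω r * t) / ω r) ^ 2) (Icc a b) := by
      fun_prop
    exact h2.integrableOn_Icc.mono_set Ioc_subset_Icc_self
  calc _ ≤ Real.exp (-(b ^ 2 * t)) * (a ^ ((n : ℝ) - 2 * θ) / (1 + m ^ 2)) *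
        ((1 + m ^ 2) / a ^ ((n : ℝ) - 2 * θ) *
          ∫ r in Ioc a b, r ^ (n - 1) * (Real.sin (ω r * t) / ω r) ^ 2) :=
        mul_le_mul_of_nonneg_left hmain (by positivity)
    _ = ∫ r in Ioc a b, Real.exp (-(b ^ 2 * t)) *
          (r ^ (n - 1) * (Real.sin (ω r * t) / ω r) ^ 2) := by
        rw [integral_const_mul]
        field_simp
    _ ≤ _ := by
        refine setIntegral_mono_on (hint.const_mul _)
          ((integrableOn_pow_mul_waveKernel_sq n ht.le).mono_set
            (Ioc_subset_Ioc ha.le hb)) measurableSet_Ioc fun r hr => ?_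
        have hr0 : 0 < r := ha.trans hr.1
        rw [waveKernel_sq, mul_left_comm]
        have hexp : Real.exp (-(b ^ 2 * t)) ≤ Real.exp (-(r ^ 2 * t)) := by
          have := hr.2
          gcongr
        have := pow_pos hr0 (n - 1)
        gcongr

/-- Before the first oscillation the kernel is comparable to `t`. -/
theorem le_integral_waveKernel_sq_of_sqrt_mul_le (hθ : 0 < θ) (hθ1 : θ ≤ 1) (ht : 0 < t) {ρ : ℝ}
    (hρ : ρ ∈ Ioc (0 : ℝ) 1) (hρt : Real.sqrt (1 + m ^ 2) * ρ ^ θ * t ≤ 1) :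
    Real.exp (-(ρ ^ 2 * t)) * (2 / Real.pi * t) ^ 2 * ρ ≤
      ∫ r in Ioc 0 ρ, r ^ (1 - 1) * waveKernel m θ t r ^ 2 := by
  calc Real.exp (-(ρ ^ 2 * t)) * (2 / Real.pi * t) ^ 2 * ρ =
        ∫ r in Ioc 0 ρ, Real.exp (-(ρ ^ 2 * t)) * (2 / Real.pi * t) ^ 2 := by
          simp [hρ.1.le]
          ring
    _ ≤ _ := by
      refine setIntegral_mono_on (integrableOn_const (by simp))
        ((integrableOn_pow_mul_waveKernel_sq 1 ht.le).mono_set (Ioc_subset_Ioc_right hρ.2))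
        measurableSet_Ioc fun r hr => ?_
      have hr' : r ∈ Ioc (0 : ℝ) 1 := ⟨hr.1, hr.2.trans hρ.2⟩
      have hw := Real.sqrt_pos.2 (freqSq_pos (m := m) hθ hr')
      have hwt : Real.sqrt (freqSq m θ r) * t ≤ 1 := by
        refine le_trans ?_ hρt
        gcongr
        rw [Real.sqrt_le_left (by have := Real.rpow_nonneg hρ.1.le θ; positivity), mul_pow,
          Real.sq_sqrt (by positivity), ← Real.rpow_natCast (ρ ^ θ), ← Real.rpow_mul hρ.1.le,
          show θ * ((2 : ℕ) : ℝ) = 2 * θ by push_cast; ring]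
        refine (freqSq_le hθ1 hr').trans ?_
        have := hr.1.le
        have := hr.2
        gcongr
      have hsin : 2 / Real.pi * t ≤
          Real.sin (Real.sqrt (freqSq m θ r) * t) / Real.sqrt (freqSq m θ r) := by
        rw [le_div_iff₀ hw]
        have := Real.mul_le_sin (mul_nonneg hw.le ht.le)
          (hwt.trans (by linarith [Real.pi_gt_three]))
        linarith
      rw [Nat.sub_self, pow_zero, one_mul, waveKernel_sq]
      have h1 := hr.1.le
      have h2 := hr.2
      have := Real.pi_pos
      gcongr

end Lower

/-! ### Reduction to radial integrals -/

section Reduction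

variable {n : ℕ} {m θ : ℝ} {u₁ : L2 n} {u v : ℝ → L2 n}

theorem integrable_indicator_waveKernel_sq (hn : 1 ≤ n) {t : ℝ} (ht : 0 ≤ t) {S : Set ℝ}
    (hS : MeasurableSet S) (hS1 : S ⊆ Ioc 0 1) :
    Integrable fun ξ : EuclideanSpace ℝ (Fin n) =>
      S.indicator (fun r => waveKernel m θ t r ^ 2) (2 * Real.pi * ‖ξ‖) := by
  rw [integrable_radial_iff hn (S.indicator fun r => waveKernel m θ t r ^ 2)]
  have h1 : (fun r : ℝ => r ^ (n - 1) * S.indicator (fun r => waveKernel m θ t r ^ 2) r) =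
      S.indicator fun r => r ^ (n - 1) * waveKernel m θ t r ^ 2 := by
    ext r
    by_cases hr : r ∈ S <;> simp [hr]
  rw [h1]
  exact (((integrableOn_pow_mul_waveKernel_sq n ht).mono_set hS1).integrable_indicator
    hS).integrableOn

theorem integral_indicator_waveKernel_sq (hn : 1 ≤ n) (m θ t : ℝ) {S : Set ℝ}
    (hS : MeasurableSet S) (hS1 : S ⊆ Ioc 0 1) :
    ∫ ξ : EuclideanSpace ℝ (Fin n),
        S.indicator (fun r => waveKernel m θ t r ^ 2) (2 * Real.pi * ‖ξ‖) =
      sphereConst n * ∫ r in S, r ^ (n - 1) * waveKernel m θ t r ^ 2 := by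
  rw [integral_radial hn (S.indicator fun r => waveKernel m θ t r ^ 2)]
  have h1 : (fun r : ℝ => r ^ (n - 1) * S.indicator (fun r => waveKernel m θ t r ^ 2) r) =
      S.indicator fun r => r ^ (n - 1) * waveKernel m θ t r ^ 2 := by
    ext r
    by_cases hr : r ∈ S <;> simp [hr]
  rw [h1, setIntegral_indicator hS, inter_eq_self_of_subset_right
    (hS1.trans Ioc_subset_Ioi_self)]

/-- Upper bound for the solution by the radial integral, up to an exponentially small term. -/
theorem IsMildSolution.norm_sq_le (hn : 1 ≤ n) (hθ : 0 < θ) (h1 : Integrable fun x => u₁ x)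
    (h : IsMildSolution m θ 0 u₁ u v) {t : ℝ} (ht : 0 ≤ t) :
    ‖u t‖ ^ 2 ≤ l1Norm u₁ ^ 2 *
        (sphereConst n * ∫ r in Ioc 0 1, r ^ (n - 1) * waveKernel m θ t r ^ 2) +
      (t * Real.exp (-(1 / 2) * t) * ‖u₁‖) ^ 2 := by
  have hnorm : Measurable fun ξ : EuclideanSpace ℝ (Fin n) => 2 * Real.pi * ‖ξ‖ := by fun_prop
  have hS : MeasurableSet {ξ : EuclideanSpace ℝ (Fin n) | 1 < 2 * Real.pi * ‖ξ‖} :=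
    measurableSet_lt measurable_const hnorm
  have : Nonempty (Fin n) := ⟨⟨0, hn⟩⟩
  rw [← Lp.norm_fourier_eq (u t), ← integral_norm_sq_eq, ← integral_add_compl hS
    (integrable_norm_sq _), add_comm]
  refine add_le_add ?_ (h.integral_fourier_sq_le hθ ht)
  rw [← integral_indicator_waveKernel_sq hn m θ t measurableSet_Ioc subset_rfl,
    ← integral_const_mul, ← integral_indicator hS.compl]
  refine integral_mono_ae ((integrable_norm_sq _).indicator hS.compl)
    ((integrable_indicator_waveKernel_sq hn ht measurableSet_Ioc subset_rfl).const_mul _) ?_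
  have hne : ∀ᵐ ξ : EuclideanSpace ℝ (Fin n), ξ ≠ 0 := by
    rw [ae_iff]
    simp
  filter_upwards [h.fourier_eq_of_le_one hθ (fun r hr => freqSq_pos hθ hr) ht,
    norm_fourier_le_l1Norm h1, hne] with ξ hξ hξ1 hξ0
  by_cases hle : 1 < 2 * Real.pi * ‖ξ‖
  · rw [indicator_of_notMem (show ξ ∉ {ξ | 1 < 2 * Real.pi * ‖ξ‖}ᶜ from not_not_intro hle),
      indicator_of_notMem (fun hc => absurd hc.2 (not_le.2 hle)), mul_zero]
  · have hmem : 2 * Real.pi * ‖ξ‖ ∈ Ioc (0 : ℝ) 1 :=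
      ⟨mul_pos (by positivity) (norm_pos_iff.2 hξ0), not_lt.1 hle⟩
    rw [indicator_of_mem (show ξ ∈ {ξ | 1 < 2 * Real.pi * ‖ξ‖}ᶜ from hle), indicator_of_mem hmem,
      hξ hmem, norm_mul, mul_pow, Complex.norm_real, Real.norm_eq_abs, sq_abs, mul_comm]
    exact mul_le_mul_of_nonneg_right (pow_le_pow_left₀ (norm_nonneg _) hξ1 2) (sq_nonneg _)

/-- Lower bound for the solution by the radial integral near the origin, where the transform of
the initial velocity is close to the moment. -/
theorem IsMildSolution.exists_le_norm_sq (hn : 1 ≤ n) (hθ : 0 < θ) (h1 : Integrable fun x => u₁ x)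
    (h : IsMildSolution m θ 0 u₁ u v) :
    ∃ δ : ℝ, 0 < δ ∧ δ ≤ 1 ∧ ∀ t, 0 ≤ t → ∀ a b : ℝ, 0 ≤ a → b ≤ δ →
      ‖moment u₁‖ ^ 2 / 4 *
        (sphereConst n * ∫ r in Ioc a b, r ^ (n - 1) * waveKernel m θ t r ^ 2) ≤ ‖u t‖ ^ 2 := by
  by_cases hP : moment u₁ = 0
  · exact ⟨1, one_pos, le_rfl, fun t _ a b _ _ => by simp [hP]⟩
  obtain ⟨δ, hδ, hδP⟩ := exists_moment_le_norm_fourier h1 hP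
  refine ⟨min δ 1, lt_min hδ one_pos, min_le_right _ _, fun t ht a b ha hb => ?_⟩
  have hsub : Ioc a b ⊆ Ioc (0 : ℝ) 1 := Ioc_subset_Ioc ha (hb.trans (min_le_right _ _))
  rw [← integral_indicator_waveKernel_sq hn m θ t measurableSet_Ioc hsub, ← integral_const_mul,
    ← Lp.norm_fourier_eq (u t), ← integral_norm_sq_eq]
  refine integral_mono_ae
    ((integrable_indicator_waveKernel_sq hn ht measurableSet_Ioc hsub).const_mul _)
    (integrable_norm_sq _) ?_
  filter_upwards [h.fourier_eq_of_le_one hθ (fun r hr => freqSq_pos hθ hr) ht, hδP] with ξ hξ hξP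
  by_cases hmem : 2 * Real.pi * ‖ξ‖ ∈ Ioc a b
  · have hP2 := hξP (hmem.2.trans (hb.trans (min_le_left _ _)))
    rw [indicator_of_mem hmem, hξ (hsub hmem), norm_mul, mul_pow, Complex.norm_real,
      Real.norm_eq_abs, sq_abs, mul_comm]
    refine mul_le_mul_of_nonneg_left ?_ (sq_nonneg _)
    calc ‖moment u₁‖ ^ 2 / 4 = (‖moment u₁‖ / 2) ^ 2 := by ring
      _ ≤ _ := pow_le_pow_left₀ (by positivity) hP2 2
  · rw [indicator_of_notMem hmem, mul_zero]
    positivity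

/-- The exponentially small term is eventually dominated by any power of `t`. If `‖u₁‖₁ = 0` this
holds because `u₁` vanishes. -/
theorem eventually_exp_term_le (h1 : Integrable fun x => u₁ x) (p : ℝ) :
    ∀ᶠ t : ℝ in atTop, (t * Real.exp (-(1 / 2) * t) * ‖u₁‖) ^ 2 ≤ l1Norm u₁ ^ 2 * t ^ (-p) := by
  have hl0 : 0 ≤ l1Norm u₁ := integral_nonneg fun x => norm_nonneg _
  rcases hl0.eq_or_lt with hl | hl
  · have hzero : u₁ = 0 := by
      have h2 := (integral_eq_zero_iff_of_nonneg (fun x => norm_nonneg _) h1.norm).1 hl.symm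
      rw [Lp.eq_zero_iff_ae_eq_zero]
      filter_upwards [h2] with x hx
      simpa using hx
    filter_upwards with t
    rw [← hl]
    simp [hzero]
  · have hlim : Tendsto (fun t : ℝ => t ^ (2 + p) * Real.exp (-1 * t) * ‖u₁‖ ^ 2) atTop (𝓝 0) := by
      have := (tendsto_rpow_mul_exp_neg_mul_atTop_nhds_zero (2 + p) 1 one_pos).mul_const
        (‖u₁‖ ^ 2)
      rwa [zero_mul] at this
    filter_upwards [hlim.eventually_le_const (pow_pos hl 2), eventually_gt_atTop 0] with t ht ht0
    have hexp : Real.exp (-(1 / 2) * t) ^ 2 = Real.exp (-1 * t) := by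
      rw [← Real.exp_nat_mul]
      congr 1
      push_cast
      ring
    rw [mul_pow, mul_pow, hexp, Real.rpow_neg ht0.le, ← div_eq_mul_inv,
      le_div_iff₀ (Real.rpow_pos_of_pos ht0 p)]
    rw [Real.rpow_add ht0, Real.rpow_two] at ht
    linarith

end Reduction

/-! ### Asymptotics of the norm -/

section Asymptotics

variable {n : ℕ} {m θ : ℝ}

theorem rpow_sq_eq_rpow {t x y : ℝ} (ht : 0 < t) (h : y = 2 * x) : (t ^ x) ^ 2 = t ^ y := by
  rw [h, ← Real.rpow_natCast, ← Real.rpow_mul ht.le]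
  congr 1
  push_cast
  ring

theorem l1Norm_nonneg (f : L2 n) : 0 ≤ l1Norm f := integral_nonneg fun _ => norm_nonneg _

theorem l1Norm_le_add (θ : ℝ) (f : L2 n) : l1Norm f ≤ l1Norm f + weightedL1Norm θ f :=
  le_add_of_nonneg_right <| integral_nonneg fun x =>
    mul_nonneg (add_nonneg zero_le_one (Real.rpow_nonneg (norm_nonneg x) θ)) (norm_nonneg _)

/-- The decay estimate. For the lower bound the radial integral is restricted to
`r ∈ (t^{-1/2}, κ t^{-1/2})`, with `κ` so large that the phase covers many oscillations. -/
theorem norm_decay (hn : 1 ≤ n) (hθ : 0 < θ) (hθ1 : θ ≤ 1) (hnθ : 2 * θ < n) (hm : 0 < m) :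
    ∃ C₁ : ℝ, 0 < C₁ ∧ ∃ C₂ : ℝ, 0 < C₂ ∧
      ∀ (u₁ : L2 n), MemWeightedL1 θ u₁ →
      ∀ (u v : ℝ → L2 n), IsMildSolution m θ 0 u₁ u v →
        ∀ᶠ t : ℝ in atTop,
          C₁ * ‖moment u₁‖ * t ^ (-(((n : ℝ) - 2 * θ) / 4)) ≤ ‖u t‖ ∧
          ‖u t‖ ≤ C₂ * (l1Norm u₁ + weightedL1Norm θ u₁) * t ^ (-(((n : ℝ) - 2 * θ) / 4)) := by
  have hs := sphereConst_pos hn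
  set A : ℝ := m ^ 2 / (2 * (1 + m ^ 2)) with hA
  have hA0 : 0 < A := by positivity
  have hA1 : A ≤ 1 := by
    rw [hA, div_le_one (by positivity)]
    nlinarith [sq_nonneg m]
  -- With this choice `log (A κ^{2θ}) = 8`.
  set κ : ℝ := (Real.exp 8 / A) ^ (1 / (2 * θ)) with hκ
  have hκ0 : 0 < κ := by positivity
  have hκ1 : 1 ≤ κ := by
    refine Real.one_le_rpow ?_ (by positivity)
    rw [one_le_div hA0]
    exact hA1.trans (Real.one_le_exp (by norm_num))
  have hκA : A * κ ^ (2 * θ) = Real.exp 8 := by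
    rw [hκ, ← Real.rpow_mul (by positivity), one_div_mul_cancel (by positivity), Real.rpow_one]
    field_simp
  set c : ℝ := sphereConst n * Real.exp (-κ ^ 2) / (4 * (1 + m ^ 2)) with hc
  have hc0 : 0 < c := by positivity
  set D : ℝ := sphereConst n * (Real.Gamma ((n - 2 * θ) / 2) / m ^ 2) + 1 with hD
  have hD0 : 0 < D := by
    have := Real.Gamma_pos_of_pos (show 0 < ((n : ℝ) - 2 * θ) / 2 by linarith)
    positivity
  refine ⟨Real.sqrt c, Real.sqrt_pos.2 hc0, Real.sqrt D, Real.sqrt_pos.2 hD0,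
    fun u₁ hu₁ u v h => ?_⟩
  obtain ⟨δ, hδ, hδ1, hlow⟩ := h.exists_le_norm_sq hn hθ hu₁.1
  have hlim : Tendsto (fun t : ℝ => κ * t ^ (-(1 / 2) : ℝ)) atTop (𝓝 0) := by
    have := (tendsto_rpow_neg_atTop (show (0 : ℝ) < 1 / 2 by norm_num)).const_mul κ
    rwa [mul_zero] at this
  have hlim2 : Tendsto (fun t : ℝ => m * t ^ (1 - θ / 2)) atTop atTop :=
    (tendsto_rpow_atTop (by linarith)).const_mul_atTop hm
  filter_upwards [eventually_gt_atTop 0, hlim.eventually_le_const hδ,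
    hlim2.eventually_ge_atTop 1, eventually_exp_term_le hu₁.1 ((n - 2 * θ) / 2)]
    with t ht htδ htm hexp
  have hsq : (t ^ (-(((n : ℝ) - 2 * θ) / 4))) ^ 2 = t ^ (-(((n : ℝ) - 2 * θ) / 2)) :=
    rpow_sq_eq_rpow ht (by ring)
  have hpow : 0 < t ^ (-(((n : ℝ) - 2 * θ) / 4)) := Real.rpow_pos_of_pos ht _
  constructor
  · have ha : 0 < t ^ (-(1 / 2) : ℝ) := Real.rpow_pos_of_pos ht _
    have hab : t ^ (-(1 / 2) : ℝ) ≤ κ * t ^ (-(1 / 2) : ℝ) := le_mul_of_one_le_left ha.le hκ1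
    have h1 := le_integral_waveKernel_sq hn hθ hθ1 hm hnθ.le ht ha hab (htδ.trans hδ1)
    have h2 := hlow t ht.le _ _ ha.le htδ
    have e1 : (κ * t ^ (-(1 / 2) : ℝ)) ^ 2 * t = κ ^ 2 := by
      rw [mul_pow, rpow_sq_eq_rpow ht (show (-1 : ℝ) = 2 * -(1 / 2) by norm_num), Real.rpow_neg_one]
      field_simp
    have e2 : (t ^ (-(1 / 2) : ℝ)) ^ ((n : ℝ) - 2 * θ) = t ^ (-(((n : ℝ) - 2 * θ) / 2)) := by
      rw [← Real.rpow_mul ht.le]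
      congr 1
      ring
    have e3 : t * (t ^ (-(1 / 2) : ℝ)) ^ θ = t ^ (1 - θ / 2) := by
      rw [← Real.rpow_mul ht.le, ← Real.rpow_one_add' ht.le (by linarith)]
      congr 1
      ring
    rw [e1, e2, e3, mul_div_cancel_right₀ _ ha.ne', hκA, Real.log_exp] at h1
    have hbr : (1 : ℝ) ≤ 8 / 4 - 1 / (m * t ^ (1 - θ / 2)) := by
      have : 1 / (m * t ^ (1 - θ / 2)) ≤ 1 := div_le_one_of_le₀ htm (by positivity)
      linarith
    have h3 : Real.exp (-κ ^ 2) * (t ^ (-(((n : ℝ) - 2 * θ) / 2)) / (1 + m ^ 2)) ≤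
        ∫ r in Ioc (t ^ (-(1 / 2) : ℝ)) (κ * t ^ (-(1 / 2) : ℝ)),
          r ^ (n - 1) * waveKernel m θ t r ^ 2 :=
      (le_mul_of_one_le_right (by positivity) hbr).trans h1
    refine (pow_le_pow_iff_left₀ (by positivity) (norm_nonneg _) two_ne_zero).1 ?_
    rw [mul_pow, mul_pow, Real.sq_sqrt hc0.le, hsq]
    refine le_trans (le_of_eq ?_) ((mul_le_mul_of_nonneg_left
      (mul_le_mul_of_nonneg_left h3 hs.le) (by positivity)).trans h2)
    rw [hc]
    field_simp
  · have h1 := h.norm_sq_le hn hθ hu₁.1 ht.le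
    have h2 := integral_waveKernel_sq_le_rpow hn hθ hm hnθ ht
    have hl := l1Norm_nonneg u₁
    have h3 : ‖u t‖ ≤ Real.sqrt D * l1Norm u₁ * t ^ (-(((n : ℝ) - 2 * θ) / 4)) := by
      refine (pow_le_pow_iff_left₀ (norm_nonneg _) (by positivity) two_ne_zero).1 ?_
      rw [mul_pow, mul_pow, Real.sq_sqrt hD0.le, hsq]
      calc ‖u t‖ ^ 2 ≤ l1Norm u₁ ^ 2 * (sphereConst n * (Real.Gamma ((n - 2 * θ) / 2) / m ^ 2 *
            t ^ (-(((n : ℝ) - 2 * θ) / 2)))) + l1Norm u₁ ^ 2 * t ^ (-(((n : ℝ) - 2 * θ) / 2)) :=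
            h1.trans (add_le_add (by gcongr) hexp)
        _ = _ := by
            rw [hD]
            ring
    refine h3.trans ?_
    have := l1Norm_le_add θ u₁
    gcongr

/-- The polynomial growth in dimension one, where the frequencies of order `t^{-1/θ}` dominate. -/
theorem norm_growth : ∃ C₁ : ℝ, 0 < C₁ ∧ ∀ M : ℝ, 0 < M → ∃ C₂ : ℝ, 0 < C₂ ∧
    ∀ (θ m : ℝ), 1 / 2 < θ → θ ≤ 1 → 0 < m → m ≤ M →
      ∀ (u₁ : L2 1), MemWeightedL1 θ u₁ →
      ∀ (u v : ℝ → L2 1), IsMildSolution m θ 0 u₁ u v →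
        ∀ᶠ t : ℝ in atTop,
          C₁ / (1 + m ^ 2) ^ (1 / (4 * θ)) * ‖moment u₁‖ * t ^ ((2 * θ - 1) / (2 * θ)) ≤ ‖u t‖ ∧
          ‖u t‖ ≤ C₂ / m * (1 / Real.sqrt (2 * θ - 1)) * (l1Norm u₁ + weightedL1Norm θ u₁) *
            t ^ ((2 * θ - 1) / (2 * θ)) := by
  have hs := sphereConst_pos (n := 1) le_rfl
  have hπ := Real.pi_pos
  set c : ℝ := sphereConst 1 * Real.exp (-1) / Real.pi ^ 2 with hc
  have hc0 : 0 < c := by positivity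
  refine ⟨Real.sqrt c, Real.sqrt_pos.2 hc0, fun M hM => ?_⟩
  set D : ℝ := sphereConst 1 * (M ^ 2 + 2) + M ^ 2 with hD
  have hD0 : 0 < D := by positivity
  refine ⟨Real.sqrt D, Real.sqrt_pos.2 hD0, fun θ m hθ hθ1 hm hmM u₁ hu₁ u v h => ?_⟩
  have hθ0 : 0 < θ := by linarith
  have hd : 0 < 2 * θ - 1 := by linarith
  obtain ⟨δ, hδ, hδ1, hlow⟩ := h.exists_le_norm_sq le_rfl hθ0 hu₁.1
  filter_upwards [eventually_ge_atTop 1, eventually_ge_atTop (1 / δ),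
    eventually_exp_term_le hu₁.1 0] with t ht htδ hexp
  have ht0 : 0 < t := one_pos.trans_le ht
  have hsq : (t ^ ((2 * θ - 1) / (2 * θ))) ^ 2 = t ^ ((2 * θ - 1) / θ) :=
    rpow_sq_eq_rpow ht0 (by field_simp)
  have hpow : 0 < t ^ ((2 * θ - 1) / (2 * θ)) := Real.rpow_pos_of_pos ht0 _
  have hm1 : 0 < 1 + m ^ 2 := by positivity
  constructor
  · set s : ℝ := Real.sqrt (1 + m ^ 2) with hsdef
    have hs1 : 1 ≤ s := Real.one_le_sqrt.2 (by nlinarith)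
    have hs0 : 0 < s := one_pos.trans_le hs1
    have hst : 1 ≤ s * t := one_le_mul_of_one_le_of_one_le hs1 ht
    -- Up to this frequency the phase is at most one.
    set ρ : ℝ := (s * t) ^ (-(1 / θ)) with hρ
    have hρ0 : 0 < ρ := by positivity
    have hρt : ρ ≤ t⁻¹ := by
      calc ρ ≤ (s * t) ^ (-1 : ℝ) := by
            refine Real.rpow_le_rpow_of_exponent_le hst (neg_le_neg ?_)
            rwa [one_le_div hθ0]
        _ = (s * t)⁻¹ := Real.rpow_neg_one _
        _ ≤ t⁻¹ := inv_anti₀ ht0 (le_mul_of_one_le_left ht0.le hs1)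
    have hρδ : ρ ≤ δ := by
      refine hρt.trans ?_
      rw [← one_div, one_div_le ht0 hδ]
      exact htδ
    have hphase : s * ρ ^ θ * t ≤ 1 := by
      rw [hρ, ← Real.rpow_mul (by positivity), show -(1 / θ) * θ = -1 by field_simp,
        Real.rpow_neg_one]
      refine le_of_eq ?_
      field_simp
    have h1 := le_integral_waveKernel_sq_of_sqrt_mul_le (m := m) hθ0 hθ1 ht0
      ⟨hρ0, hρδ.trans hδ1⟩ hphase
    have h2 := hlow t ht0.le 0 ρ le_rfl hρδ
    have hgauss : Real.exp (-1) ≤ Real.exp (-(ρ ^ 2 * t)) := by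
      rw [Real.exp_le_exp, neg_le_neg_iff]
      have hρ1 : ρ ≤ 1 := hρδ.trans hδ1
      have hρt' : ρ * t ≤ 1 := by
        calc ρ * t ≤ t⁻¹ * t := by gcongr
          _ = 1 := inv_mul_cancel₀ ht0.ne'
      nlinarith
    have hρval : t ^ 2 * ρ = t ^ ((2 * θ - 1) / θ) / (1 + m ^ 2) ^ (1 / (2 * θ)) := by
      have e1 : s ^ (-(1 / θ)) = ((1 + m ^ 2) ^ (1 / (2 * θ)))⁻¹ := by
        rw [hsdef, Real.sqrt_eq_rpow, ← Real.rpow_mul hm1.le, ← Real.rpow_neg hm1.le]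
        congr 1
        field_simp
      have e2 : t ^ 2 * t ^ (-(1 / θ)) = t ^ ((2 * θ - 1) / θ) := by
        rw [← Real.rpow_natCast, ← Real.rpow_add ht0]
        congr 1
        push_cast
        field_simp
        ring
      rw [hρ, Real.mul_rpow hs0.le ht0.le, e1, ← e2]
      ring
    have hmsq : ((1 + m ^ 2) ^ (1 / (4 * θ))) ^ 2 = (1 + m ^ 2) ^ (1 / (2 * θ)) :=
      rpow_sq_eq_rpow hm1 (by field_simp; norm_num)
    refine (pow_le_pow_iff_left₀ (by positivity) (norm_nonneg _) two_ne_zero).1 ?_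
    rw [mul_pow, mul_pow, div_pow, Real.sq_sqrt hc0.le, hsq, hmsq]
    calc _ = ‖moment u₁‖ ^ 2 / 4 * (sphereConst 1 *
          (Real.exp (-1) * (2 / Real.pi) ^ 2 * (t ^ 2 * ρ))) := by
          rw [hρval, hc]
          field_simp
          ring
      _ ≤ ‖moment u₁‖ ^ 2 / 4 * (sphereConst 1 *
          (Real.exp (-(ρ ^ 2 * t)) * (2 / Real.pi) ^ 2 * (t ^ 2 * ρ))) := by gcongr
      _ = ‖moment u₁‖ ^ 2 / 4 * (sphereConst 1 *
          (Real.exp (-(ρ ^ 2 * t)) * (2 / Real.pi * t) ^ 2 * ρ)) := by ring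
      _ ≤ _ := (mul_le_mul_of_nonneg_left (mul_le_mul_of_nonneg_left h1 hs.le)
          (by positivity)).trans h2
  · have h1 := h.norm_sq_le le_rfl hθ0 hu₁.1 ht0.le
    have h2 := integral_waveKernel_sq_le_growth hθ hm ht
    have hl := l1Norm_nonneg u₁
    have hpow1 : 1 ≤ t ^ ((2 * θ - 1) / θ) := Real.one_le_rpow ht (by positivity)
    rw [neg_zero, Real.rpow_zero, mul_one] at hexp
    have hd1 : 2 * θ - 1 ≤ 1 := by linarith
    -- All lower-order constants are absorbed by means of `m² (2θ - 1) ≤ M²`.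
    have habs : 1 ≤ M ^ 2 / (m ^ 2 * (2 * θ - 1)) := by
      rw [one_le_div (by positivity)]
      calc m ^ 2 * (2 * θ - 1) ≤ M ^ 2 * 1 := by gcongr
        _ = M ^ 2 := mul_one _
    have h3 : ‖u t‖ ≤ Real.sqrt D / m * (1 / Real.sqrt (2 * θ - 1)) * l1Norm u₁ *
        t ^ ((2 * θ - 1) / (2 * θ)) := by
      refine (pow_le_pow_iff_left₀ (norm_nonneg _) (by positivity) two_ne_zero).1 ?_
      rw [mul_pow, mul_pow, mul_pow, div_pow, div_pow, one_pow, Real.sq_sqrt hD0.le,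
        Real.sq_sqrt hd.le, hsq]
      calc ‖u t‖ ^ 2 ≤ l1Norm u₁ ^ 2 * (sphereConst 1 * ((1 + 2 / (m ^ 2 * (2 * θ - 1))) *
            t ^ ((2 * θ - 1) / θ))) + l1Norm u₁ ^ 2 * 1 := by
            rw [mul_one]
            exact h1.trans (add_le_add (by gcongr) hexp)
        _ ≤ l1Norm u₁ ^ 2 * (sphereConst 1 *
              ((M ^ 2 / (m ^ 2 * (2 * θ - 1)) + 2 / (m ^ 2 * (2 * θ - 1))) *
                t ^ ((2 * θ - 1) / θ))) +
              l1Norm u₁ ^ 2 * (M ^ 2 / (m ^ 2 * (2 * θ - 1)) * t ^ ((2 * θ - 1) / θ)) := by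
            gcongr
            exact one_le_mul_of_one_le_of_one_le habs hpow1
        _ = _ := by
            rw [hD]
            field_simp
    refine h3.trans ?_
    have := l1Norm_le_add θ u₁
    gcongr

/-- The logarithmic growth in the critical case `n = 2θ`, where all frequencies between `t^{-1/θ}`
and `t^{-1/2}` contribute; the lower bound uses those above `t^{-3/4}`. -/
theorem norm_log_growth (hn : 1 ≤ n) (hnθ : (n : ℝ) = 2 * θ) (hθ1 : θ ≤ 1) (hm : 0 < m)
    {s s' : ℝ} (hs' : 0 < s') (hs's : s' ≤ sphereConst n) (hs : sphereConst n ≤ s)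
    {u₁ : L2 n} (hu₁ : MemWeightedL1 θ u₁) {u v : ℝ → L2 n} (h : IsMildSolution m θ 0 u₁ u v) :
    ∀ᶠ t : ℝ in atTop,
      Real.sqrt (s' * Real.exp (-1) / 128) / Real.sqrt (2 + m ^ 2) * ‖moment u₁‖ *
        Real.sqrt (Real.log t) ≤ ‖u t‖ ∧
      ‖u t‖ ≤ Real.sqrt (4 * s + 1) / m * (l1Norm u₁ + weightedL1Norm θ u₁) *
        Real.sqrt (Real.log t) := by
  have hsn := sphereConst_pos hn
  have hs0 : 0 < s := hsn.trans_le hs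
  have hθ : 1 / 2 ≤ θ := by
    have : (1 : ℝ) ≤ n := by exact_mod_cast hn
    linarith
  have hθ0 : 0 < θ := by linarith
  obtain ⟨δ, hδ, hδ1, hlow⟩ := h.exists_le_norm_sq hn hθ0 hu₁.1
  set A : ℝ := m ^ 2 / (2 * (1 + m ^ 2)) with hA
  have hA0 : 0 < A := by positivity
  have hlim : Tendsto (fun t : ℝ => t ^ (-(1 / 2) : ℝ)) atTop (𝓝 0) :=
    tendsto_rpow_neg_atTop (by norm_num)
  have hlim2 : Tendsto (fun t : ℝ => m * t ^ (1 - 3 / 4 * θ)) atTop atTop :=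
    (tendsto_rpow_atTop (by linarith)).const_mul_atTop hm
  filter_upwards [eventually_ge_atTop 1, hlim.eventually_le_const hδ,
    hlim2.eventually_ge_atTop 1, eventually_exp_term_le hu₁.1 0,
    Real.tendsto_log_atTop.eventually_ge_atTop (m ^ 2 * (s + 1)),
    Real.tendsto_log_atTop.eventually_ge_atTop (32 * (1 - Real.log A / 4))]
    with t ht htδ htm hexp hlog1 hlog2
  have ht0 : 0 < t := one_pos.trans_le ht
  have hlog0 : 0 ≤ Real.log t := Real.log_nonneg ht
  constructor
  · have ha : 0 < t ^ (-(3 / 4) : ℝ) := Real.rpow_pos_of_pos ht0 _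
    have hab : t ^ (-(3 / 4) : ℝ) ≤ t ^ (-(1 / 2) : ℝ) :=
      Real.rpow_le_rpow_of_exponent_le ht (by norm_num)
    have h1 := le_integral_waveKernel_sq hn hθ0 hθ1 hm hnθ.ge ht0 ha hab (htδ.trans hδ1)
    have h2 := hlow t ht0.le _ _ ha.le htδ
    have e1 : (t ^ (-(1 / 2) : ℝ)) ^ 2 * t = 1 := by
      rw [rpow_sq_eq_rpow ht0 (show (-1 : ℝ) = 2 * -(1 / 2) by norm_num), Real.rpow_neg_one,
        inv_mul_cancel₀ ht0.ne']
    have e2 : (t ^ (-(3 / 4) : ℝ)) ^ ((n : ℝ) - 2 * θ) = 1 := by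
      rw [hnθ, sub_self, Real.rpow_zero]
    have e3 : t * (t ^ (-(3 / 4) : ℝ)) ^ θ = t ^ (1 - 3 / 4 * θ) := by
      rw [← Real.rpow_mul ht0.le, ← Real.rpow_one_add' ht0.le (by linarith)]
      congr 1
      ring
    have e4 : (t ^ (-(1 / 2) : ℝ) / t ^ (-(3 / 4) : ℝ)) ^ (2 * θ) = t ^ (θ / 2) := by
      rw [← Real.rpow_sub ht0, ← Real.rpow_mul ht0.le]
      congr 1
      ring
    rw [e1, e2, e3, e4, ← hA, Real.log_mul hA0.ne' (Real.rpow_pos_of_pos ht0 _).ne',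
      Real.log_rpow ht0] at h1
    have hbr : Real.log t / 32 ≤
        (Real.log A + θ / 2 * Real.log t) / 4 - 1 / (m * t ^ (1 - 3 / 4 * θ)) := by
      have : 1 / (m * t ^ (1 - 3 / 4 * θ)) ≤ 1 := div_le_one_of_le₀ htm (by positivity)
      nlinarith
    have h3 : Real.exp (-1) * (1 / (1 + m ^ 2)) * (Real.log t / 32) ≤
        ∫ r in Ioc (t ^ (-(3 / 4) : ℝ)) (t ^ (-(1 / 2) : ℝ)),
          r ^ (n - 1) * waveKernel m θ t r ^ 2 :=
      (mul_le_mul_of_nonneg_left hbr (by positivity)).trans h1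
    refine (pow_le_pow_iff_left₀ (by positivity) (norm_nonneg _) two_ne_zero).1 ?_
    rw [mul_pow, mul_pow, div_pow, Real.sq_sqrt (by positivity), Real.sq_sqrt (by positivity),
      Real.sq_sqrt hlog0]
    calc _ ≤ sphereConst n * Real.exp (-1) / 128 / (1 + m ^ 2) * ‖moment u₁‖ ^ 2 *
          Real.log t := by
          gcongr
          norm_num
      _ = ‖moment u₁‖ ^ 2 / 4 * (sphereConst n *
          (Real.exp (-1) * (1 / (1 + m ^ 2)) * (Real.log t / 32))) := by
          field_simp
          ring
      _ ≤ _ := (mul_le_mul_of_nonneg_left (mul_le_mul_of_nonneg_left h3 hsn.le)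
          (by positivity)).trans h2
  · have h1 := h.norm_sq_le hn hθ0 hu₁.1 ht0.le
    have h2 := integral_waveKernel_sq_le_log hn hnθ hm ht
    have hl := l1Norm_nonneg u₁
    rw [neg_zero, Real.rpow_zero] at hexp
    have hcoef : 2 / (m ^ 2 * θ) ≤ 4 / m ^ 2 := by
      rw [div_le_div_iff₀ (by positivity) (by positivity)]
      nlinarith [sq_nonneg m]
    have h3 : ‖u t‖ ≤ Real.sqrt (4 * s + 1) / m * l1Norm u₁ * Real.sqrt (Real.log t) := by
      refine (pow_le_pow_iff_left₀ (norm_nonneg _) (by positivity) two_ne_zero).1 ?_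
      rw [mul_pow, mul_pow, div_pow, Real.sq_sqrt (by positivity), Real.sq_sqrt hlog0]
      have hlog3 : s + 1 ≤ Real.log t / m ^ 2 := by
        rw [le_div_iff₀ (by positivity)]
        linarith
      calc ‖u t‖ ^ 2 ≤ l1Norm u₁ ^ 2 * (sphereConst n * (1 + 2 / (m ^ 2 * θ) * Real.log t)) +
            l1Norm u₁ ^ 2 * 1 := h1.trans (add_le_add (by gcongr) hexp)
        _ ≤ l1Norm u₁ ^ 2 * (s * (1 + 4 / m ^ 2 * Real.log t)) + l1Norm u₁ ^ 2 * 1 := by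
            gcongr
        _ = l1Norm u₁ ^ 2 * (4 * s / m ^ 2 * Real.log t + (s + 1)) := by ring
        _ ≤ l1Norm u₁ ^ 2 * (4 * s / m ^ 2 * Real.log t + Real.log t / m ^ 2) := by gcongr
        _ = _ := by
            field_simp
    refine h3.trans ?_
    have := l1Norm_le_add θ u₁
    gcongr

end Asymptotics

theorem theorem1p2 :
    -- decay
    (∀ (n : ℕ) (θ m : ℝ), 0 < θ → 0 < m →
      ((n = 1 ∧ θ < 1 / 2) ∨ (n = 2 ∧ θ < 1) ∨ (3 ≤ n ∧ θ ≤ 1)) →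
      ∃ C₁ : ℝ, 0 < C₁ ∧ ∃ C₂ : ℝ, 0 < C₂ ∧
        ∀ (u₁ : L2 n), MemWeightedL1 θ u₁ →
        ∀ (u v : ℝ → L2 n), IsMildSolution m θ 0 u₁ u v →
          ∀ᶠ t : ℝ in atTop,
            C₁ * ‖moment u₁‖ * t ^ (-(((n : ℝ) - 2 * θ) / 4)) ≤ ‖u t‖ ∧
            ‖u t‖ ≤ C₂ * (l1Norm u₁ + weightedL1Norm θ u₁) * t ^ (-(((n : ℝ) - 2 * θ) / 4))) ∧
    -- polynomial growth in dimension one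
    (∃ C₁ : ℝ, 0 < C₁ ∧ ∀ M : ℝ, 0 < M → ∃ C₂ : ℝ, 0 < C₂ ∧
      ∀ (θ m : ℝ), 1 / 2 < θ → θ ≤ 1 → 0 < m → m ≤ M →
        ∀ (u₁ : L2 1), MemWeightedL1 θ u₁ →
        ∀ (u v : ℝ → L2 1), IsMildSolution m θ 0 u₁ u v →
          ∀ᶠ t : ℝ in atTop,
            C₁ / (1 + m ^ 2) ^ (1 / (4 * θ)) * ‖moment u₁‖ * t ^ ((2 * θ - 1) / (2 * θ)) ≤ ‖u t‖ ∧
            ‖u t‖ ≤ C₂ / m * (1 / Real.sqrt (2 * θ - 1)) * (l1Norm u₁ + weightedL1Norm θ u₁) *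
              t ^ ((2 * θ - 1) / (2 * θ))) ∧
    -- logarithmic growth in the critical cases
    (∃ C₁ : ℝ, 0 < C₁ ∧ ∃ C₂ : ℝ, 0 < C₂ ∧
      ∀ (n : ℕ) (θ m : ℝ), ((n = 1 ∧ θ = 1 / 2) ∨ (n = 2 ∧ θ = 1)) → 0 < m →
        ∀ (u₁ : L2 n), MemWeightedL1 θ u₁ →
        ∀ (u v : ℝ → L2 n), IsMildSolution m θ 0 u₁ u v →
          ∀ᶠ t : ℝ in atTop,
            C₁ / Real.sqrt (2 + m ^ 2) * ‖moment u₁‖ * Real.sqrt (Real.log t) ≤ ‖u t‖ ∧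
            ‖u t‖ ≤ C₂ / m * (l1Norm u₁ + weightedL1Norm θ u₁) * Real.sqrt (Real.log t)) := by
  refine ⟨fun n θ m hθ hm hcase => ?_, norm_growth, ?_⟩
  · rcases hcase with ⟨rfl, h⟩ | ⟨rfl, h⟩ | ⟨hn, h⟩
    · exact norm_decay le_rfl hθ (by linarith) (by push_cast; linarith) hm
    · exact norm_decay one_le_two hθ h.le (by push_cast; linarith) hm
    · have hn3 : (3 : ℝ) ≤ n := by exact_mod_cast hn
      exact norm_decay (by omega) hθ h (by linarith) hm
  · have h1 := sphereConst_pos (n := 1) le_rfl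
    have h2 := sphereConst_pos (n := 2) one_le_two
    have hmin : 0 < min (sphereConst 1) (sphereConst 2) := lt_min h1 h2
    refine ⟨Real.sqrt (min (sphereConst 1) (sphereConst 2) * Real.exp (-1) / 128), by positivity,
      Real.sqrt (4 * max (sphereConst 1) (sphereConst 2) + 1),
      Real.sqrt_pos.2 (by have := le_max_left (sphereConst 1) (sphereConst 2); linarith),
      fun n θ m hcase hm u₁ hu₁ u v h => ?_⟩
    rcases hcase with ⟨rfl, rfl⟩ | ⟨rfl, rfl⟩
    · exact norm_log_growth le_rfl (by norm_num) (by norm_num) hm hmin (min_le_left _ _)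
        (le_max_left _ _) hu₁ h
    · exact norm_log_growth one_le_two (by norm_num) le_rfl hm hmin (min_le_right _ _)
        (le_max_right _ _) hu₁ h
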